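/- Let $d\ge 1$, and let $(\Omega,\mathcal F,\mathbf P^\circ)$ be a measure space ($\mathbf P^\circ$ need not be a probability measure). Let $(E,\mathcal E)$ be a measurable space on which the additive group $\mathbb R^d$ acts by maps $\theta_t$ such that $(t,x)\mapsto\theta_t x$ is measurable, and let $X$ be a random element in $(E,\mathcal E)$. Let $Z=(Z_s)_{s\in\mathbb R^d}$ be a shift-measurable random field with values in $[0,\infty)$, i.e. a random element in a shift-invariant set $H$ of functions $z:\mathbb R^d\to[0,\infty)$, equipped with the trace of the product $\sigma$-algebra, for which $(t,z)\mapsto\theta_t z:=(z_{t+s})_{s\in\mathbb R^d}$ is measurable. Let $\xi$ be a (locally finite) random measure on $\mathbb R^d$ with density field $Z$, i.e. $\xi(ds)=Z_s\,ds$, and let the distribution of $((X,Z),\xi)$ under $\mathbf P^\circ$ be $\sigma$-finite. Suppose that $Z_s>0$ everywhere for all $s$, and that $Z$ is locally integrable along all lines and has infinite integral along all half-lines. Put $\theta_t\xi(B)=\xi(B+t)$ and let $\theta_t$ act componentwise on pairs; let $\lambda$ be Lebesgue measure on $\mathbb R^d$. The pair $((X,Z),\xi)$ is called mass-stationary if for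 all bounded Borel sets $C\subset\mathbb R^d$ with $\lambda(C)>0$ and $\lambda(\partial C)=0$, under $\mathbf P^\circ$, $$\bigl(\theta_{V_C}((X,Z),\xi),\,V_C+U_C\bigr)\overset{D}{=}\bigl(((X,Z),\xi),\,U_C\bigr),$$ where the conditional distribution of $U_C$ given $((X,Z),\xi)$ is uniform on $C$ and the conditional distribution of $V_C$ given $(((X,Z),\xi),U_C)$ is $\xi(\,\cdot\mid C-U_C)$. A measurable map $\pi:H\to\mathbb R^d$ is called a preserving shift if, for each fixed value of $Z$, the allocation rule $\tau(s)=s+\pi(\theta_s Z)$ satisfies $\xi(\{s:\tau(s)\in B\})=\xi(B)$ for all Borel $B\subseteq\mathbb R^d$. The pair $(X,Z)$ is called distributionally invariant under preserving shifts if $\theta_{\pi(Z)}(X,Z)\overset{D}{=}(X,Z)$ under $\mathbf P^\circ$ for all preserving shifts $\pi$. Then $((X,Z),\xi)$ is mass-stationary if and only if $(X,Z)$ is distributionally invariant under preserving shifts. -/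

import Mathlib

open MeasureTheory ProbabilityTheory
open scoped NNReal ENNReal

namespace MassShift

/-- The space `ℝ^d`. -/
abbrev Space (d : ℕ) : Type := EuclideanSpace ℝ (Fin d)

/-- The shift of a measure on `ℝ^d`: `(θ_t μ)(B) = μ (B + t)`. -/
noncomputable def shiftMeasure {d : ℕ} (t : Space d) (μ : Measure (Space d)) :
    Measure (Space d) :=
  μ.map (fun s => s - t)

theorem shiftMeasure_apply {d : ℕ} (t : Space d) (μ : Measure (Space d))
    {B : Set (Space d)} (hB : MeasurableSet B) :
    shiftMeasure t μ B = μ ((fun s => s + t) '' B) := by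
  rw [shiftMeasure, Measure.map_apply (by fun_prop) hB]
  congr 1
  ext s
  constructor
  · intro hs
    exact ⟨s - t, hs, by simp⟩
  · rintro ⟨y, hy, rfl⟩
    simpa using hy

/-- The path set of a shift-measurable nonnegative random field on `ℝ^d`: a set of functions
`ℝ^d → [0, ∞)`, invariant under all shifts and equipped with the trace of the product
σ-algebra, such that the map `(t, z) ↦ θ_t z` is (jointly) measurable,
where `(θ_t z)(s) = z (t + s)`. -/
structure PathSpace (d : ℕ) where
  /-- the set of paths -/
  paths : Set (Space d → ℝ≥0)
  shift_mem : ∀ (t : Space d), ∀ z ∈ paths, (fun s => z (t + s)) ∈ paths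
  measurable_shift : Measurable (fun p : Space d × paths =>
    (⟨fun s => (p.2 : Space d → ℝ≥0) (p.1 + s), shift_mem p.1 p.2 p.2.2⟩ : paths))

/-- The action `θ` of `ℝ^d` on a path set by shifts. -/
instance PathSpace.instAddAction {d : ℕ} (H : PathSpace d) : AddAction (Space d) H.paths where
  vadd t z := ⟨fun s => (z : Space d → ℝ≥0) (t + s), H.shift_mem t z z.2⟩
  zero_vadd z := Subtype.ext (funext fun s => congrArg (z : Space d → ℝ≥0) (zero_add s))
  add_vadd t r z := Subtype.ext (funext fun s =>
    congrArg (z : Space d → ℝ≥0) (by abel : t + r + s = r + (t + s)))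

theorem PathSpace.vadd_apply {d : ℕ} (H : PathSpace d) (t : Space d) (z : H.paths)
    (s : Space d) : ((t +ᵥ z : H.paths) : Space d → ℝ≥0) s = (z : Space d → ℝ≥0) (t + s) :=
  rfl

section

variable {d : ℕ} {Ω : Type*} [MeasurableSpace Ω]

/-- `ξ` is a random measure on `ℝ^d`: measurable and locally finite. -/
structure IsRandomMeasure (ξ : Ω → Measure (Space d)) : Prop where
  measurable : Measurable ξ
  locallyFinite : ∀ ω, IsLocallyFiniteMeasure (ξ ω)

/-- The random measure `ξ` has the density field `Z`: `ξ(ds) = Z_s ds`. -/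
def HasDensityField {H : PathSpace d} (ξ : Ω → Measure (Space d)) (Z : Ω → H.paths) : Prop :=
  ∀ ω, ξ ω = volume.withDensity (fun s => ((Z ω : Space d → ℝ≥0) s : ℝ≥0∞))

/-- `(X, ξ)` is mass-stationary under `P`: for all bounded Borel sets `C` with `λ(C) > 0` and
`λ(∂C) = 0`, the distribution of `(θ_V (X, ξ), V + U)` is that of `((X, ξ), U)`, where
`U` given `(X, ξ)` is uniform on `C` and `V` given `((X, ξ), U)` has distribution
`ξ(· | C - U)`. The identity in distribution is expressed by integrals of nonnegative
measurable functions. Here `volume[|C]` and `(ξ ω)[|A]` are the conditional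
(normalised restricted) measures. -/
def MassStationary {E : Type*} [MeasurableSpace E] [AddAction (Space d) E]
    (P : Measure Ω) (X : Ω → E) (ξ : Ω → Measure (Space d)) : Prop :=
  ∀ C : Set (Space d), MeasurableSet C → Bornology.IsBounded C →
    0 < volume C → volume (frontier C) = 0 →
    ∀ f : (E × Measure (Space d)) × Space d → ℝ≥0∞, Measurable f →
      ∫⁻ ω, ∫⁻ u, ∫⁻ v, f ((v +ᵥ X ω, shiftMeasure v (ξ ω)), v + u)
          ∂(cond (ξ ω) ((fun y => y - u) '' C)) ∂(cond volume C) ∂P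
        = ∫⁻ ω, ∫⁻ u, f ((X ω, ξ ω), u) ∂(cond volume C) ∂P

/-- The allocation rule `τ(s) = s + π(θ_s z)` induced by `π` and the path `z`. -/
def allocation {H : PathSpace d} (π : H.paths → Space d) (z : H.paths) (s : Space d) : Space d :=
  s + π (s +ᵥ z)

/-- The measurable map `π` is a preserving shift: for each fixed value of the field `Z`,
the induced allocation rule preserves `ξ`. -/
structure IsPreservingShift {H : PathSpace d} (ξ : Ω → Measure (Space d)) (Z : Ω → H.paths)
    (π : H.paths → Space d) : Prop where
  measurable : Measurable π
  preserves : ∀ ω, ∀ B : Set (Space d), MeasurableSet B →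
    ξ ω {s | allocation π (Z ω) s ∈ B} = ξ ω B

/-- `(X, Z)` is distributionally invariant under preserving shifts (under `P`):
`θ_{π(Z)} (X, Z)` and `(X, Z)` have the same distribution for all preserving `π`. -/
def InvariantUnderPreservingShifts {E : Type*} [MeasurableSpace E] [AddAction (Space d) E]
    {H : PathSpace d} (P : Measure Ω) (X : Ω → E) (Z : Ω → H.paths)
    (ξ : Ω → Measure (Space d)) : Prop :=
  ∀ π : H.paths → Space d, IsPreservingShift ξ Z π →
    P.map (fun ω => (π (Z ω) +ᵥ X ω, π (Z ω) +ᵥ Z ω)) = P.map (fun ω => (X ω, Z ω))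

end

end MassShift

namespace MassShift

/-! Both properties are equivalent to the Mecke equation `Mecke` for the law `Q` of `(X, Z)`: the
Campbell measure `Q(dy) ρ(T s y) ds` is invariant under moving the origin to the sampled point, `(y,
s) ↦ (T s y, -s)`.

Mecke implies invariance (`Mecke.map_eq`): this is mass transport. Spread unit mass around the
target of the origin; since the allocation preserves `ξ`, exchanging sender and receiver gives back
`Q`.

Invariance implies Mecke: for a direction `u ≠ 0` and `r : ℝ`, walk along `u` until the signed mass
`r` is collected on the line. Positivity and infinite mass on half-lines make this well defined, and
it is a preserving shift (`lintegral_comp_line_allocation`). Invariance under all `r` is the Mecke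
equation along the line (`mecke_of_invariant`); averaging over `u` gives the full equation
(`mecke_of_line`).

Mass-stationarity and Mecke (`flowMassStationary_iff_mecke`): the mass of `C - U` does not change
when the origin and `U` move together, so the denominator can be removed, which leaves the Campbell
symmetry seen through a window `C`. The windows together recover the whole symmetry
(`mecke_of_windowExchange`).

The hypotheses concern only the paths `Z ω`; their shifts inherit them, so the argument runs on the
orbit space of `Z` and is transferred back at the end. -/

/-- A jointly measurable action of an additive group `G` on `Y`. -/
structure MeasurableFlow (G Y : Type*) [AddCommGroup G] [MeasurableSpace G]
    [MeasurableSpace Y] where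
  /-- the action -/
  toFun : G → Y → Y
  map_zero : ∀ y, toFun 0 y = y
  map_add : ∀ s t y, toFun (s + t) y = toFun s (toFun t y)
  measurable_uncurry : Measurable (fun p : G × Y => toFun p.1 p.2)

namespace MeasurableFlow

variable {G Y : Type*} [AddCommGroup G] [MeasurableSpace G] [MeasurableSpace Y]

instance : CoeFun (MeasurableFlow G Y) (fun _ => G → Y → Y) := ⟨toFun⟩

@[fun_prop]
theorem measurable {α : Type*} [MeasurableSpace α] (T : MeasurableFlow G Y) {s : α → G}
    {y : α → Y} (hs : Measurable s) (hy : Measurable y) :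
    Measurable (fun a => T (s a) (y a)) :=
  T.measurable_uncurry.comp (hs.prodMk hy)

end MeasurableFlow

/-! ### The Mecke equation and mass transport. -/

section Mecke

variable {G Y : Type*} [AddCommGroup G] [MeasurableSpace G] [MeasurableSpace Y]

/-- The Mecke equation for a measure `Q` on `Y` and the random measure whose density with
respect to `μ` is `s ↦ ρ (T s y)`. -/
def Mecke (T : MeasurableFlow G Y) (μ : Measure G) (ρ : Y → ℝ≥0) (Q : Measure Y) : Prop :=
  ∀ F : Y × G → ℝ≥0∞, Measurable F →
    ∫⁻ y, ∫⁻ s, F (y, s) * ρ (T s y) ∂μ ∂Q = ∫⁻ y, ∫⁻ s, F (T s y, -s) * ρ (T s y) ∂μ ∂Q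

/-- Under the Mecke equation, allocation rules that preserve the random measure leave `Q`
invariant. -/
theorem Mecke.map_eq [MeasurableAdd₂ G] [MeasurableNeg G] {T : MeasurableFlow G Y}
    {μ : Measure G} [SFinite μ]
    [μ.IsAddLeftInvariant] {ρ : Y → ℝ≥0} (hρ : Measurable ρ) {Q : Measure Y}
    (hQ : Mecke T μ ρ Q) {B : Set G} (hB : MeasurableSet B)
    (hB0 : ∀ y, ∫⁻ s in B, ρ (T s y) ∂μ ≠ 0) (hBtop : ∀ y, ∫⁻ s in B, ρ (T s y) ∂μ ≠ ∞)
    {π : Y → G} (hπ : Measurable π)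
    (hpres : ∀ y (g : G → ℝ≥0∞), Measurable g →
      ∫⁻ s, g (s + π (T s y)) * ρ (T s y) ∂μ = ∫⁻ s, g s * ρ (T s y) ∂μ) :
    Q.map (fun y => T (π y) y) = Q := by
  have hm : Measurable (fun y => T (π y) y) := by fun_prop
  set m : Y → ℝ≥0∞ := fun y => ∫⁻ s in B, ρ (T s y) ∂μ with hm_def
  have hmm : Measurable m := by
    apply Measurable.lintegral_prod_right'
      (f := fun p : Y × G => (ρ (T p.2 p.1) : ℝ≥0∞))
    fun_prop
  -- The normalised restriction to `B`: a kernel of total mass one for the random measure seen from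
  -- any `y`.
  set k : Y × G → ℝ≥0∞ := fun p => (m p.1)⁻¹ * B.indicator 1 p.2 with hk
  have hkm : Measurable k := by
    have : Measurable (B.indicator (1 : G → ℝ≥0∞)) := measurable_one.indicator hB
    fun_prop
  have hk1 : ∀ y, ∫⁻ s, k (y, s) * ρ (T s y) ∂μ = 1 := by
    intro y
    have : ∀ s, k (y, s) * ρ (T s y)
        = (m y)⁻¹ * B.indicator (fun s => (ρ (T s y) : ℝ≥0∞)) s := by
      intro s
      by_cases hs : s ∈ B <;> simp [hk, hs]
    simp_rw [this]
    rw [lintegral_const_mul _ (by apply Measurable.indicator _ hB; fun_prop),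
      lintegral_indicator hB, ENNReal.inv_mul_cancel (hB0 y) (hBtop y)]
  have hkc : ∀ y, ∀ c : ℝ≥0∞, ∫⁻ s, c * k (y, s) * ρ (T s y) ∂μ = c := by
    intro y c
    simp_rw [mul_assoc]
    rw [lintegral_const_mul _ (by fun_prop), hk1, mul_one]
  ext A hA
  set f : Y → ℝ≥0∞ := A.indicator 1 with hf
  have hfm : Measurable f := measurable_one.indicator hA
  rw [← lintegral_indicator_one hA, ← lintegral_indicator_one hA, lintegral_map hfm hm]
  -- The kernel is centred at the target `π y` of the origin. The left side then integrates to `f (T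
  -- (π y) y)`; on the right side `s` enters only through `s + π (T s y)`, so preservation applies
  -- and produces the right side of `e2`.
  have e1 := hQ (fun p => f (T (π p.1) p.1) * k (T (π p.1) p.1, p.2 + -π p.1)) (by fun_prop)
  have e2 := hQ (fun p => f p.1 * k (p.1, p.2)) (by fun_prop)
  have e3 : ∀ y, ∫⁻ s, f (T (π y) y) * k (T (π y) y, s + -π y) * ρ (T s y) ∂μ
      = f (T (π y) y) := by
    intro y
    rw [← lintegral_add_left_eq_self _ (π y)]
    refine Eq.trans ?_ (hkc (T (π y) y) (f (T (π y) y)))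
    refine lintegral_congr fun s => ?_
    rw [← T.map_add, add_comm s (π y)]
    simp
  have e4 : ∀ y, ∫⁻ s, f (T (π (T s y)) (T s y))
        * k (T (π (T s y)) (T s y), -s + -π (T s y)) * ρ (T s y) ∂μ
      = ∫⁻ s, f (T s y) * k (T s y, -s) * ρ (T s y) ∂μ := by
    intro y
    rw [← hpres y (fun s => f (T s y) * k (T s y, -s)) (by fun_prop)]
    refine lintegral_congr fun s => ?_
    rw [← T.map_add, add_comm s, neg_add_rev, add_comm (-s)]
  simp only [e3, e4] at e1
  simp only [hkc] at e2
  exact e1.trans e2.symm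

end Mecke

/-! ### Densities on the line and their cumulative mass. -/

/-- A positive locally integrable function on the real line with infinite integrals over all
half-lines starting at `0`. -/
structure IsLineDensity (g : ℝ → ℝ≥0) : Prop where
  measurable : Measurable g
  pos : ∀ a, 0 < g a
  locallyIntegrable : LocallyIntegrable (fun a => (g a : ℝ)) volume
  lintegral_Ici : ∫⁻ a in Set.Ici 0, (g a : ℝ≥0∞) = ∞
  lintegral_Iic : ∫⁻ a in Set.Iic 0, (g a : ℝ≥0∞) = ∞

namespace IsLineDensity

variable {g : ℝ → ℝ≥0} (hg : IsLineDensity g)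

include hg

theorem intervalIntegrable (a b : ℝ) :
    IntervalIntegrable (fun a => (g a : ℝ)) volume a b :=
  (hg.locallyIntegrable.integrableOn_isCompact isCompact_uIcc).intervalIntegrable

theorem ofReal_intervalIntegral {a b : ℝ} (hab : a ≤ b) :
    ENNReal.ofReal (∫ x in a..b, (g x : ℝ)) = ∫⁻ x in Set.Ioc a b, (g x : ℝ≥0∞) := by
  rw [intervalIntegral.integral_of_le hab, ofReal_integral_eq_lintegral_ofReal]
  · simp
  · exact (intervalIntegrable_iff_integrableOn_Ioc_of_le hab).1 (hg.intervalIntegrable a b)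
  · exact Filter.Eventually.of_forall fun x => (g x).2

theorem strictMono : StrictMono (fun a => ∫ x in (0 : ℝ)..a, (g x : ℝ)) := by
  intro a b hab
  have h := intervalIntegral.integral_add_adjacent_intervals (hg.intervalIntegrable 0 a)
    (hg.intervalIntegrable a b)
  have h2 : 0 < ∫ x in a..b, (g x : ℝ) :=
    intervalIntegral.intervalIntegral_pos_of_pos (hg.intervalIntegrable a b)
      (fun x => by exact_mod_cast hg.pos x) hab
  simp only
  linarith

theorem continuous : Continuous (fun a => ∫ x in (0 : ℝ)..a, (g x : ℝ)) :=
  intervalIntegral.continuous_primitive (fun a b => hg.intervalIntegrable a b) 0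

theorem surjective : Function.Surjective (fun a => ∫ x in (0 : ℝ)..a, (g x : ℝ)) := by
  apply hg.continuous.surjective
  · rw [hg.strictMono.monotone.tendsto_atTop_atTop_iff]
    intro r
    by_contra! h
    have hU : (⋃ n : ℕ, Set.Ioc (0 : ℝ) n) = Set.Ioi 0 := by
      ext x
      simp only [Set.mem_iUnion, Set.mem_Ioc, Set.mem_Ioi]
      exact ⟨fun ⟨n, hn⟩ => hn.1, fun hx => (exists_nat_ge x).imp fun n hn => ⟨hx, hn⟩⟩
    have h2 := setLIntegral_iUnion_of_directed (μ := volume) (fun x => (g x : ℝ≥0∞))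
      (s := fun n : ℕ => Set.Ioc (0 : ℝ) n) (Monotone.directed_le fun m n hmn =>
        Set.Ioc_subset_Ioc_right (by exact_mod_cast hmn))
    rw [hU, setLIntegral_congr Ioi_ae_eq_Ici, hg.lintegral_Ici] at h2
    -- A bounded cumulative mass would contradict the infinite integral over the half-line.
    have h3 : (⨆ n : ℕ, ∫⁻ x in Set.Ioc (0 : ℝ) n, (g x : ℝ≥0∞)) ≤ ENNReal.ofReal r := by
      refine iSup_le fun n => ?_
      rw [← hg.ofReal_intervalIntegral (Nat.cast_nonneg n)]
      exact ENNReal.ofReal_le_ofReal (h n).le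
    rw [← h2] at h3
    simp at h3
  · rw [hg.strictMono.monotone.tendsto_atBot_atBot_iff]
    intro r
    by_contra! h
    have hU : (⋃ n : ℕ, Set.Ioc (-n : ℝ) 0) = Set.Iic 0 := by
      ext x
      simp only [Set.mem_iUnion, Set.mem_Ioc, Set.mem_Iic]
      exact ⟨fun ⟨n, hn⟩ => hn.2,
        fun hx => (exists_nat_gt (-x)).imp fun n hn => ⟨by linarith, hx⟩⟩
    have h2 := setLIntegral_iUnion_of_directed (μ := volume) (fun x => (g x : ℝ≥0∞))
      (s := fun n : ℕ => Set.Ioc (-n : ℝ) 0) (Monotone.directed_le fun m n hmn =>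
        Set.Ioc_subset_Ioc_left (by simpa using hmn))
    rw [hU, hg.lintegral_Iic] at h2
    have h3 : (⨆ n : ℕ, ∫⁻ x in Set.Ioc (-n : ℝ) 0, (g x : ℝ≥0∞)) ≤ ENNReal.ofReal (-r) := by
      refine iSup_le fun n => ?_
      rw [← hg.ofReal_intervalIntegral (by simp)]
      apply ENNReal.ofReal_le_ofReal
      rw [intervalIntegral.integral_symm]
      linarith [h (-n)]
    rw [← h2] at h3
    simp at h3

/-- The cumulative mass function of a line density, as an order isomorphism of the line. -/
noncomputable def orderIso : ℝ ≃o ℝ :=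
  hg.strictMono.orderIsoOfSurjective _ hg.surjective

theorem orderIso_apply (a : ℝ) : hg.orderIso a = ∫ x in (0 : ℝ)..a, (g x : ℝ) := rfl

theorem map_withDensity :
    (volume.withDensity (fun a => (g a : ℝ≥0∞))).map hg.orderIso = volume := by
  have hm : Measurable hg.orderIso := hg.orderIso.continuous.measurable
  refine (Measure.ext_of_Ioc _ _ fun a b hab => ?_).symm
  rw [Measure.map_apply hm measurableSet_Ioc]
  have : hg.orderIso ⁻¹' Set.Ioc a b
      = Set.Ioc (hg.orderIso.symm a) (hg.orderIso.symm b) := by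
    rw [OrderIso.preimage_Ioc]
  rw [this, withDensity_apply _ measurableSet_Ioc,
    ← hg.ofReal_intervalIntegral (hg.orderIso.symm.monotone hab.le), Real.volume_Ioc]
  congr 1
  have h := intervalIntegral.integral_add_adjacent_intervals
    (hg.intervalIntegrable 0 (hg.orderIso.symm a))
    (hg.intervalIntegrable (hg.orderIso.symm a) (hg.orderIso.symm b))
  rw [← hg.orderIso_apply, ← hg.orderIso_apply, OrderIso.apply_symm_apply,
    OrderIso.apply_symm_apply] at h
  linarith

/-- Substitution of the cumulative mass. -/
theorem lintegral_mul_eq (f : ℝ → ℝ≥0∞) (hf : Measurable f) :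
    ∫⁻ a, f a * g a = ∫⁻ r, f (hg.orderIso.symm r) := by
  have hm : Measurable hg.orderIso := hg.orderIso.continuous.measurable
  have hm' : Measurable hg.orderIso.symm := hg.orderIso.symm.continuous.measurable
  have hgm := hg.measurable
  conv_rhs => rw [← hg.map_withDensity]
  rw [lintegral_map (by fun_prop) hm, lintegral_withDensity_eq_lintegral_mul _ (by fun_prop)
    (by fun_prop)]
  simp [mul_comm]

theorem orderIso_translate {g' : ℝ → ℝ≥0} (hg' : IsLineDensity g') (c : ℝ)
    (h : ∀ a, g' a = g (a + c)) (a : ℝ) :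
    hg'.orderIso a = hg.orderIso (a + c) - hg.orderIso c := by
  simp only [orderIso_apply, h]
  rw [intervalIntegral.integral_comp_add_right (fun x => (g x : ℝ)), zero_add,
    intervalIntegral.integral_interval_sub_left (hg.intervalIntegrable _ _)
      (hg.intervalIntegrable _ _)]

theorem orderIso_symm_translate {g' : ℝ → ℝ≥0} (hg' : IsLineDensity g') (c : ℝ)
    (h : ∀ a, g' a = g (a + c)) (r : ℝ) :
    hg'.orderIso.symm r = hg.orderIso.symm (r + hg.orderIso c) - c := by
  rw [OrderIso.symm_apply_eq, hg.orderIso_translate hg' c h]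
  simp

end IsLineDensity

/-! ### Shifts by a given mass along a one-dimensional flow. -/

section Flow

variable {Y : Type*} [MeasurableSpace Y] (T : MeasurableFlow ℝ Y) {ρ : Y → ℝ≥0}
  (hρ : ∀ y, IsLineDensity (fun a => ρ (T a y)))

/-- The time that the flow `T` started in `y` needs to collect the mass `r`. -/
noncomputable def massTime (y : Y) (r : ℝ) : ℝ := (hρ y).orderIso.symm r

theorem massTime_flow (y : Y) (a r : ℝ) :
    massTime T hρ (T a y) r = massTime T hρ y (r + (hρ y).orderIso a) - a :=
  (hρ y).orderIso_symm_translate (hρ (T a y)) a (fun b => by rw [T.map_add]) r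

/-- In the mass coordinate the walk is additive: collecting `r` and then `r'` is collecting `r' +
r`. -/
theorem massTime_flow_massTime (y : Y) (r r' : ℝ) :
    massTime T hρ (T (massTime T hρ y r) y) r'
      = massTime T hρ y (r' + r) - massTime T hρ y r := by
  rw [massTime_flow]
  congr 2
  simp [massTime]

theorem massTime_zero (y : Y) : massTime T hρ y 0 = 0 := by
  rw [massTime, OrderIso.symm_apply_eq, IsLineDensity.orderIso_apply]
  simp

/-- The inverse is at most `a` exactly when `r` is at most the cumulative mass at `a`, and the
latter is an integral depending measurably on `y`. -/
theorem measurable_massTime (hm : Measurable ρ) :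
    Measurable (fun p : Y × ℝ => massTime T hρ p.1 p.2) := by
  refine measurable_of_Iic fun a => ?_
  have : (fun p : Y × ℝ => massTime T hρ p.1 p.2) ⁻¹' Set.Iic a
      = {p | p.2 ≤ (hρ p.1).orderIso a} := by
    ext p
    simp only [massTime, Set.mem_preimage, Set.mem_Iic, Set.mem_ofPred_eq]
    exact OrderIso.symm_apply_le _
  rw [this]
  refine measurableSet_le measurable_snd ?_
  have h : Measurable (fun y : Y => ∫ x in (0 : ℝ)..a, (ρ (T x y) : ℝ)) := by
    simp only [intervalIntegral]
    refine Measurable.sub ?_ ?_ <;>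
    · refine StronglyMeasurable.measurable ?_
      apply StronglyMeasurable.integral_prod_right'
        (f := fun (p : Y × ℝ) => (ρ (T p.2 p.1) : ℝ))
      exact Measurable.stronglyMeasurable (by fun_prop)
  exact h.comp measurable_fst

/-- In the mass coordinate the measure becomes Lebesgue measure and the allocation becomes
translation by `r`. -/
theorem lintegral_comp_allocation (hm : Measurable ρ) (r : ℝ) (y : Y) (f : ℝ → ℝ≥0∞)
    (hf : Measurable f) :
    ∫⁻ a, f (a + massTime T hρ (T a y) r) * ρ (T a y) = ∫⁻ a, f a * ρ (T a y) := by
  have hS := measurable_massTime T hρ hm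
  rw [(hρ y).lintegral_mul_eq f hf,
    (hρ y).lintegral_mul_eq (fun a => f (a + massTime T hρ (T a y) r)) (by fun_prop),
    ← lintegral_add_left_eq_self (fun q => f ((hρ y).orderIso.symm q)) r]
  refine lintegral_congr fun q => ?_
  rw [massTime_flow]
  simp [massTime]

/-- A measure that is invariant under all mass shifts along the flow satisfies the Mecke
equation of the flow. -/
theorem mecke_of_invariant (hm : Measurable ρ) {Q : Measure Y} [SFinite Q]
    (hQ : ∀ r, Q.map (fun y => T (massTime T hρ y r) y) = Q) :
    Mecke T volume ρ Q := by
  intro f hf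
  have hS := measurable_massTime T hρ hm
  have e1 : ∀ y, ∫⁻ a, f (y, a) * ρ (T a y) = ∫⁻ r, f (y, massTime T hρ y r) := fun y =>
    (hρ y).lintegral_mul_eq (fun a => f (y, a)) (by fun_prop)
  -- Seen from the point at mass `r`, the old origin lies at mass `-r`. Both sides thus become
  -- integrals over `r`, matched by invariance and the reflection `r ↦ -r`.
  have e2 : ∀ y, ∫⁻ a, f (T a y, -a) * ρ (T a y)
      = ∫⁻ r, f (T (massTime T hρ y r) y,
          massTime T hρ (T (massTime T hρ y r) y) (-r)) := by
    intro y
    rw [(hρ y).lintegral_mul_eq (fun a => f (T a y, -a)) (by fun_prop)]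
    refine lintegral_congr fun r => ?_
    rw [massTime_flow_massTime, neg_add_cancel, massTime_zero, zero_sub]
    rfl
  simp only [e1, e2]
  have h1 : ∀ r, ∫⁻ y, f (T (massTime T hρ y r) y,
      massTime T hρ (T (massTime T hρ y r) y) (-r)) ∂Q
        = ∫⁻ y, f (y, massTime T hρ y (-r)) ∂Q := by
    intro r
    conv_rhs => rw [← hQ r]
    rw [lintegral_map (by fun_prop) (by fun_prop)]
  rw [lintegral_lintegral_swap (by fun_prop)]
  conv_rhs => rw [lintegral_lintegral_swap (by fun_prop)]
  rw [lintegral_congr h1, lintegral_neg_eq_self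
    (fun r => ∫⁻ y, f (y, massTime T hρ y r) ∂Q)]

end Flow

theorem IsLineDensity.orderIso_symm_congr {g g' : ℝ → ℝ≥0} (hg : IsLineDensity g)
    (hg' : IsLineDensity g') (h : g = g') (r : ℝ) :
    hg.orderIso.symm r = hg'.orderIso.symm r := by
  subst h
  rfl

/-! ### Line allocations in several dimensions. -/

section Lines

variable {V : Type*} [NormedAddCommGroup V] [NormedSpace ℝ V] [FiniteDimensional ℝ V]
  [MeasurableSpace V] [BorelSpace V] {Y : Type*} [MeasurableSpace Y]

/-- The restriction of a flow to the line spanned by `u`. -/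
def MeasurableFlow.line (T : MeasurableFlow V Y) (u : V) : MeasurableFlow ℝ Y where
  toFun a y := T (a • u) y
  map_zero y := by rw [zero_smul, T.map_zero]
  map_add a b y := by rw [add_smul, T.map_add]
  measurable_uncurry := by fun_prop

omit [FiniteDimensional ℝ V] in
theorem MeasurableFlow.line_apply (T : MeasurableFlow V Y) (u : V) (a : ℝ) (y : Y) :
    T.line u a y = T (a • u) y := rfl

/-- The flow of translations. -/
def MeasurableFlow.translation (V : Type*) [NormedAddCommGroup V] [NormedSpace ℝ V]
    [FiniteDimensional ℝ V] [MeasurableSpace V] [BorelSpace V] : MeasurableFlow V V where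
  toFun s x := s + x
  map_zero := zero_add
  map_add := add_assoc
  measurable_uncurry := by fun_prop

/-- The joint weight `ρ x * ρ (a • u + x)` is symmetric under exchanging the two points, so
translating `x` by `a • u` and reflecting `a` suffices. -/
theorem mecke_translation_line (μ : Measure V) [SFinite μ] [μ.IsAddLeftInvariant] (u : V)
    {ρ : V → ℝ≥0} (hρ : Measurable ρ) :
    Mecke ((MeasurableFlow.translation V).line u) volume ρ
      (μ.withDensity fun x => (ρ x : ℝ≥0∞)) := by
  intro F hF
  change ∫⁻ x, ∫⁻ a : ℝ, F (x, a) * ρ (a • u + x) ∂volume ∂(μ.withDensity _)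
    = ∫⁻ x, ∫⁻ a : ℝ, F (a • u + x, -a) * ρ (a • u + x) ∂volume ∂(μ.withDensity _)
  have m1 : Measurable (fun x => ∫⁻ a : ℝ, F (x, a) * ρ (a • u + x)) :=
    Measurable.lintegral_prod_right' (f := fun p : V × ℝ => F p * ρ (p.2 • u + p.1))
      (by fun_prop)
  have m2 : Measurable (fun x => ∫⁻ a : ℝ, F (a • u + x, -a) * ρ (a • u + x)) :=
    Measurable.lintegral_prod_right'
      (f := fun p : V × ℝ => F (p.2 • u + p.1, -p.2) * ρ (p.2 • u + p.1)) (by fun_prop)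
  rw [lintegral_withDensity_eq_lintegral_mul _ (by fun_prop) m1,
    lintegral_withDensity_eq_lintegral_mul _ (by fun_prop) m2]
  simp only [Pi.mul_apply]
  have e1 : ∀ x, (ρ x : ℝ≥0∞) * ∫⁻ a : ℝ, F (x, a) * ρ (a • u + x)
      = ∫⁻ a : ℝ, ρ x * (F (x, a) * ρ (a • u + x)) := fun x =>
    (lintegral_const_mul _ (by fun_prop)).symm
  have e2 : ∀ x, (ρ x : ℝ≥0∞) * ∫⁻ a : ℝ, F (a • u + x, -a) * ρ (a • u + x)
      = ∫⁻ a : ℝ, ρ x * (F (a • u + x, -a) * ρ (a • u + x)) := fun x =>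
    (lintegral_const_mul _ (by fun_prop)).symm
  simp only [e1, e2]
  rw [lintegral_lintegral_swap (by fun_prop)]
  conv_rhs => rw [lintegral_lintegral_swap (by fun_prop)]
  rw [← lintegral_neg_eq_self (fun a : ℝ => ∫⁻ x, ρ x * (F (x, a) * ρ (a • u + x)) ∂μ)]
  refine lintegral_congr fun a => ?_
  rw [← lintegral_add_left_eq_self _ (a • u)]
  refine lintegral_congr fun x => ?_
  have : -a • u + (a • u + x) = x := by module
  rw [this]
  ring

variable (T : MeasurableFlow V Y) {ρ : Y → ℝ≥0} (u : V)
  (hρ : ∀ y, IsLineDensity (fun a => ρ (T.line u a y)))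

/-- Moving each point along the direction `u` until the mass `r` has been collected on the line
preserves the measure with density `s ↦ ρ (T s y)`. -/
theorem lintegral_comp_line_allocation (hm : Measurable ρ) (μ : Measure V) [SFinite μ]
    [μ.IsAddLeftInvariant] (r : ℝ) (y : Y) (f : V → ℝ≥0∞) (hf : Measurable f) :
    ∫⁻ s, f (s + massTime (T.line u) hρ (T s y) r • u) * ρ (T s y) ∂μ
      = ∫⁻ s, f s * ρ (T s y) ∂μ := by
  -- The space `V` itself serves as the state space, with the measure of density `ρ'`.
  -- `Mecke.map_eq` along the line then says that this measure is preserved, without splitting `V`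
  -- into lines by coordinates.
  set W := (MeasurableFlow.translation V).line u with hW
  set ρ' : V → ℝ≥0 := fun x => ρ (T x y) with hρ'_def
  have hm' : Measurable ρ' := by fun_prop
  have key : ∀ x, (fun a => ρ' (W a x)) = fun a => ρ (T.line u a (T x y)) := by
    intro x
    funext a
    change ρ (T (a • u + x) y) = ρ (T (a • u) (T x y))
    rw [T.map_add]
  have hρ' : ∀ x, IsLineDensity (fun a => ρ' (W a x)) := fun x => by
    rw [key x]
    exact hρ _
  have hmt : ∀ x, massTime W hρ' x r = massTime (T.line u) hρ (T x y) r := fun x =>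
    IsLineDensity.orderIso_symm_congr _ _ (key x) r
  have hS := measurable_massTime W hρ' hm'
  have hB : ∀ x, ∫⁻ a in Set.Ioc (0 : ℝ) 1, (ρ' (W a x) : ℝ≥0∞)
      = ENNReal.ofReal ((hρ' x).orderIso 1) := fun x => by
    rw [(hρ' x).orderIso_apply, (hρ' x).ofReal_intervalIntegral zero_le_one]
  have h := (mecke_translation_line μ u hm').map_eq hm' (measurableSet_Ioc (a := 0) (b := 1))
    (fun x => by
      change ∫⁻ a in Set.Ioc (0 : ℝ) 1, (ρ' (W a x) : ℝ≥0∞) ≠ 0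
      rw [hB, ne_eq, ENNReal.ofReal_eq_zero, not_le]
      have := (hρ' x).strictMono zero_lt_one
      simpa [IsLineDensity.orderIso_apply] using this)
    (fun x => by
      change ∫⁻ a in Set.Ioc (0 : ℝ) 1, (ρ' (W a x) : ℝ≥0∞) ≠ ∞
      rw [hB]
      exact ENNReal.ofReal_ne_top)
    (π := fun x => massTime W hρ' x r) (by fun_prop)
    (fun x g hg => lintegral_comp_allocation W hρ' hm' r x g hg)
  have e : ∀ g : V → ℝ≥0∞, Measurable g → ∫⁻ s, g s * ρ (T s y) ∂μ
      = ∫⁻ s, g s ∂(μ.withDensity fun x => (ρ' x : ℝ≥0∞)) := by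
    intro g hg
    rw [lintegral_withDensity_eq_lintegral_mul _ (by fun_prop) hg]
    simp [ρ', mul_comm]
  simp only [← hmt]
  rw [e f hf, e (fun s => f (s + massTime W hρ' s r • u)) (by fun_prop), ← h]
  have hmap : Measurable fun y ↦ W (massTime W hρ' y r) y := by fun_prop
  rw [lintegral_map hf hmap, h]
  refine lintegral_congr fun s => ?_
  change _ = f (massTime W hρ' s r • u + s)
  rw [add_comm]

end Lines

/-! ### From lines to the whole space by averaging over directions. -/

section Average

variable {V : Type*} [NormedAddCommGroup V] [NormedSpace ℝ V] [FiniteDimensional ℝ V]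
  [MeasurableSpace V] [BorelSpace V] {Y : Type*} [MeasurableSpace Y]
  (μ : Measure V) [μ.IsAddHaarMeasure]

theorem lintegral_comp_smul {r : ℝ} (hr : r ≠ 0) {f : V → ℝ≥0∞} (hf : Measurable f) :
    ∫⁻ x, f (r • x) ∂μ
      = ENNReal.ofReal |(r ^ Module.finrank ℝ V)⁻¹| * ∫⁻ x, f x ∂μ := by
  rw [← lintegral_map hf (by fun_prop), Measure.map_addHaar_smul μ hr, lintegral_smul_measure,
    smul_eq_mul]

/-- For each `a ≠ 0` the weight is the Jacobian of `u ↦ a • u`, so the integral over `u` does not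
depend on `a`; `2` is the length of the interval. -/
theorem lintegral_average_dilation {f : V → ℝ≥0∞} (hf : Measurable f) :
    ∫⁻ u, ∫⁻ a in Set.Ioo (-1 : ℝ) 1,
        ENNReal.ofReal |a ^ Module.finrank ℝ V| * f (a • u) ∂volume ∂μ
      = 2 * ∫⁻ s, f s ∂μ := by
  rw [lintegral_lintegral_swap (by fun_prop)]
  have : ∀ᵐ a : ℝ ∂(volume.restrict (Set.Ioo (-1 : ℝ) 1)),
      ∫⁻ u, ENNReal.ofReal |a ^ Module.finrank ℝ V| * f (a • u) ∂μ = ∫⁻ s, f s ∂μ := by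
    filter_upwards [Measure.ae_ne _ 0] with a ha
    rw [lintegral_const_mul _ (by fun_prop), lintegral_comp_smul μ ha hf, ← mul_assoc,
      ← ENNReal.ofReal_mul (abs_nonneg _), ← abs_mul, mul_inv_cancel₀ (pow_ne_zero _ ha)]
    simp
  rw [lintegral_congr_ae this]
  simp [mul_comm]
  norm_num

/-- The Mecke equations along all lines imply the Mecke equation. -/
theorem mecke_of_line [Nontrivial V] (T : MeasurableFlow V Y) {ρ : Y → ℝ≥0} (hρ : Measurable ρ)
    {Q : Measure Y} [SFinite Q] (hQ : ∀ u : V, u ≠ 0 → Mecke (T.line u) volume ρ Q) :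
    Mecke T μ ρ Q := by
  intro F hF
  set w : ℝ → ℝ≥0∞ := (Set.Ioo (-1 : ℝ) 1).indicator
    (fun a => ENNReal.ofReal |a ^ Module.finrank ℝ V|) with hw
  have hwm : Measurable w := Measurable.indicator (by fun_prop) measurableSet_Ioo
  have hwneg : ∀ a, w (-a) = w a := by
    intro a
    have : -a ∈ Set.Ioo (-1 : ℝ) 1 ↔ a ∈ Set.Ioo (-1 : ℝ) 1 := by
      simp only [Set.mem_Ioo]
      constructor <;> rintro ⟨h1, h2⟩ <;> constructor <;> linarith
    simp only [hw, Set.indicator, this, abs_pow, abs_neg]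
    split_ifs <;> rfl
  have avg : ∀ G : Y × V → ℝ≥0∞, Measurable G →
      ∫⁻ u, ∫⁻ y, ∫⁻ a, w a * G (y, a • u) ∂volume ∂Q ∂μ = 2 * ∫⁻ y, ∫⁻ s, G (y, s) ∂μ ∂Q := by
    intro G hG
    rw [lintegral_lintegral_swap (by
      refine Measurable.aemeasurable ?_
      apply Measurable.lintegral_prod_right'
        (f := fun p : (V × Y) × ℝ => w p.2 * G (p.1.2, p.2 • p.1.1))
      fun_prop), ← lintegral_const_mul _ hG.lintegral_prod_right']
    refine lintegral_congr fun y => ?_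
    rw [← lintegral_average_dilation μ (f := fun s => G (y, s)) (by fun_prop)]
    refine lintegral_congr fun u => ?_
    rw [← lintegral_indicator measurableSet_Ioo]
    refine lintegral_congr fun a => ?_
    by_cases ha : a ∈ Set.Ioo (-1 : ℝ) 1 <;> simp only [hw, Set.indicator, ha, if_true, if_false,
      zero_mul]
  have h1 := avg (fun p => F p * ρ (T p.2 p.1)) (by fun_prop)
  have h2 := avg (fun p => F (T p.2 p.1, -p.2) * ρ (T p.2 p.1)) (by fun_prop)
  have h3 : ∫⁻ u, ∫⁻ y, ∫⁻ a, w a * (F (y, a • u) * ρ (T (a • u) y)) ∂volume ∂Q ∂μ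
      = ∫⁻ u, ∫⁻ y, ∫⁻ a, w a * (F (T (a • u) y, -(a • u)) * ρ (T (a • u) y))
          ∂volume ∂Q ∂μ := by
    refine lintegral_congr_ae ?_
    filter_upwards [Measure.ae_ne μ 0] with u hu
    -- The Mecke equation replaces `a` by `-a` in the test function, which is why `w` has to be
    -- even.
    have := hQ u hu (fun p => w p.2 * F (p.1, p.2 • u)) (by fun_prop)
    simpa only [mul_assoc, hwneg, neg_smul, MeasurableFlow.line_apply] using this
  rw [h1, h2] at h3
  exact (ENNReal.mul_right_inj (by simp) (by simp)).1 h3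

end Average

/-! ### Jordan sets and a generating π-system of windows. -/

section Nice

variable {V : Type*} [NormedAddCommGroup V] [NormedSpace ℝ V] [FiniteDimensional ℝ V]
  [MeasurableSpace V] [BorelSpace V] {Y : Type*} [MeasurableSpace Y]

/-- Bounded Borel sets with null boundary. -/
structure IsJordan (μ : Measure V) (C : Set V) : Prop where
  measurableSet : MeasurableSet C
  isBounded : Bornology.IsBounded C
  frontier : μ (frontier C) = 0

variable {μ : Measure V}

omit [NormedSpace ℝ V] [FiniteDimensional ℝ V] [BorelSpace V] in
theorem IsJordan.inter {B C : Set V} (hB : IsJordan μ B) (hC : IsJordan μ C) :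
    IsJordan μ (B ∩ C) where
  measurableSet := hB.measurableSet.inter hC.measurableSet
  isBounded := hB.isBounded.subset Set.inter_subset_left
  frontier := measure_mono_null (frontier_inter_subset B C) <| measure_union_null
    (measure_mono_null Set.inter_subset_left hB.frontier)
    (measure_mono_null Set.inter_subset_right hC.frontier)

omit [NormedSpace ℝ V] [FiniteDimensional ℝ V] [BorelSpace V] in
theorem IsJordan.union {B C : Set V} (hB : IsJordan μ B) (hC : IsJordan μ C) :
    IsJordan μ (B ∪ C) where
  measurableSet := hB.measurableSet.union hC.measurableSet
  isBounded := hB.isBounded.union hC.isBounded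
  frontier := measure_mono_null (frontier_union_subset B C) <| measure_union_null
    (measure_mono_null Set.inter_subset_left hB.frontier)
    (measure_mono_null Set.inter_subset_right hC.frontier)

omit [NormedSpace ℝ V] [FiniteDimensional ℝ V] [BorelSpace V] in
theorem IsJordan.diff {B C : Set V} (hB : IsJordan μ B) (hC : IsJordan μ C) :
    IsJordan μ (B \ C) where
  measurableSet := hB.measurableSet.diff hC.measurableSet
  isBounded := hB.isBounded.subset Set.sdiff_subset
  frontier := by
    rw [Set.sdiff_eq]
    exact measure_mono_null (frontier_inter_subset B Cᶜ) <| measure_union_null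
      (measure_mono_null Set.inter_subset_left hB.frontier)
      (measure_mono_null Set.inter_subset_right (by rw [frontier_compl]; exact hC.frontier))

theorem isJordan_ball [Nontrivial V] [μ.IsAddHaarMeasure] (x : V) (r : ℝ) :
    IsJordan μ (Metric.ball x r) where
  measurableSet := measurableSet_ball
  isBounded := Metric.isBounded_ball
  frontier := measure_mono_null Metric.frontier_ball_subset_sphere (Measure.addHaar_sphere μ x r)

/-- The sets `{((y, w), b) | (y, w) ∈ D, b ∈ C}` with `C` a Jordan set and `D ⊆ Y × C`. -/
def jordanRectangles (Y : Type*) [MeasurableSpace Y] (μ : Measure V) : Set (Set ((Y × V) × V)) :=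
  {S | ∃ (D : Set (Y × V)) (C : Set V), MeasurableSet D ∧ IsJordan μ C ∧ D ⊆ Prod.snd ⁻¹' C ∧
    S = D ×ˢ C}

omit [NormedSpace ℝ V] [FiniteDimensional ℝ V] [BorelSpace V] in
theorem isPiSystem_jordanRectangles : IsPiSystem (jordanRectangles Y μ) := by
  rintro _ ⟨D, C, hD, hC, hDC, rfl⟩ _ ⟨D', C', hD', hC', hDC', rfl⟩ -
  refine ⟨D ∩ D', C ∩ C', hD.inter hD', hC.inter hC', ?_, Set.prod_inter_prod⟩
  exact fun p hp => ⟨hDC hp.1, hDC' hp.2⟩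

/-- The constraint `D ⊆ Y × C` is harmless for sets in the first factor, since large balls exhaust
the space. For the second factor differences of rectangles remove it. -/
theorem generateFrom_jordanRectangles [Nontrivial V] [μ.IsAddHaarMeasure] :
    (inferInstance : MeasurableSpace ((Y × V) × V))
      = MeasurableSpace.generateFrom (jordanRectangles Y μ) := by
  have hball : ∀ x : V, ∃ n : ℕ, x ∈ Metric.ball (0 : V) n := fun x => by
    simpa using exists_nat_gt ‖x‖
  have hbasic : ∀ (D : Set (Y × V)) (C : Set V), MeasurableSet D → IsJordan μ C →
      D ⊆ Prod.snd ⁻¹' C → MeasurableSet[MeasurableSpace.generateFrom (jordanRectangles Y μ)]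
        (D ×ˢ C) := fun D C hD hC h =>
    MeasurableSpace.measurableSet_generateFrom ⟨D, C, hD, hC, h, rfl⟩
  apply le_antisymm
  · refine sup_le ?_ ?_
    · rintro _ ⟨D, hD, rfl⟩
      have : (Prod.fst ⁻¹' D : Set ((Y × V) × V)) = ⋃ n : ℕ,
          (D ∩ Prod.snd ⁻¹' Metric.ball 0 n) ×ˢ Metric.ball (0 : V) n := by
        ext ⟨⟨y, w⟩, b⟩
        simp only [Set.mem_preimage, Set.mem_iUnion, Set.mem_prod, Set.mem_inter_iff]
        constructor
        · intro h
          obtain ⟨n, hn⟩ := exists_nat_gt (max ‖w‖ ‖b‖)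
          refine ⟨n, ⟨h, ?_⟩, ?_⟩
          · simpa using (le_max_left _ _).trans_lt hn
          · simpa using (le_max_right _ _).trans_lt hn
        · rintro ⟨n, h⟩
          exact h.1.1
      rw [this]
      refine MeasurableSet.iUnion fun n => ?_
      exact hbasic _ _ (hD.inter (measurable_snd measurableSet_ball)) (isJordan_ball _ _)
        Set.inter_subset_right
    · rw [← measurable_iff_comap_le]
      have hJ : ∀ B : Set V, IsJordan μ B →
          MeasurableSet[MeasurableSpace.generateFrom (jordanRectangles Y μ)]
            (Prod.snd ⁻¹' B : Set ((Y × V) × V)) := by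
        intro B hB
        -- When `w ∉ B`, no window equal to `B` contains `w`; instead `B` is written as the
        -- difference of the windows `ball ∪ B` and `ball \ B`, both containing `w`.
        have : (Prod.snd ⁻¹' B : Set ((Y × V) × V))
            = ((Prod.snd ⁻¹' B) ×ˢ B) ∪ ⋃ n : ℕ,
              ((Prod.snd ⁻¹' (Metric.ball 0 n \ B)) ×ˢ (Metric.ball 0 n ∪ B)) \
                ((Prod.snd ⁻¹' (Metric.ball 0 n \ B)) ×ˢ (Metric.ball 0 n \ B)) := by
          ext ⟨⟨y, w⟩, b⟩
          simp only [Set.mem_preimage, Set.mem_iUnion, Set.mem_prod, Set.mem_union,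
            Set.mem_sdiff]
          constructor
          · intro h
            by_cases hw : w ∈ B
            · exact Or.inl ⟨hw, h⟩
            · obtain ⟨n, hn⟩ := hball w
              exact Or.inr ⟨n, ⟨⟨hn, hw⟩, Or.inr h⟩, fun h' => h'.2.2 h⟩
          · rintro (⟨-, h⟩ | ⟨n, ⟨h1, h2⟩, h3⟩)
            · exact h
            · by_contra hb
              exact h3 ⟨h1, h2.resolve_right hb, hb⟩
        rw [this]
        refine MeasurableSet.union (hbasic _ _ (measurable_snd hB.measurableSet) hB le_rfl)
          (MeasurableSet.iUnion fun n => ?_)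
        have hd : IsJordan μ (Metric.ball 0 n \ B) := (isJordan_ball _ _).diff hB
        refine MeasurableSet.diff
          (hbasic _ _ (measurable_snd hd.measurableSet) ((isJordan_ball _ _).union hB) ?_)
          (hbasic _ _ (measurable_snd hd.measurableSet) hd le_rfl)
        exact fun p hp => Or.inl hp.1
      refine @measurable_of_isOpen _ _ _ _ _ (MeasurableSpace.generateFrom _) _ fun U hU => ?_
      choose! r hr0 hr using Metric.isOpen_iff.1 hU
      obtain ⟨I, hI, hIU⟩ := TopologicalSpace.isOpen_iUnion_countable
        (fun x : U => Metric.ball (x : V) (r x)) (fun x => Metric.isOpen_ball)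
      have hUI : U = ⋃ x ∈ I, Metric.ball (x : V) (r x) := by
        rw [hIU]
        apply subset_antisymm
        · exact fun x hx => Set.mem_iUnion.2 ⟨⟨x, hx⟩, Metric.mem_ball_self (hr0 x hx)⟩
        · exact Set.iUnion_subset fun x => hr x x.2
      rw [hUI, Set.preimage_iUnion₂]
      exact MeasurableSet.biUnion hI fun x _ => hJ _ (isJordan_ball _ _)
  · refine MeasurableSpace.generateFrom_le ?_
    rintro _ ⟨D, C, hD, hC, -, rfl⟩
    exact hD.prod hC.measurableSet

end Nice

/-! ### Mass-stationarity and the Mecke equation. -/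

section Stationarity

variable {V : Type*} [NormedAddCommGroup V] [NormedSpace ℝ V] [FiniteDimensional ℝ V]
  [MeasurableSpace V] [BorelSpace V] {Y : Type*} [MeasurableSpace Y]

/-- The mass that the random measure with density `s ↦ ρ (T s y)` gives to `C - u`. -/
noncomputable def windowMass (T : MeasurableFlow V Y) (μ : Measure V) (ρ : Y → ℝ≥0)
    (C : Set V) (y : Y) (u : V) : ℝ≥0∞ :=
  ∫⁻ v, C.indicator 1 (v + u) * ρ (T v y) ∂μ

/-- Mass-stationarity of a measure on the state space of a flow. -/
def FlowMassStationary (T : MeasurableFlow V Y) (μ : Measure V) (ρ : Y → ℝ≥0)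
    (Q : Measure Y) : Prop :=
  ∀ C, IsJordan μ C → 0 < μ C → ∀ f : Y × V → ℝ≥0∞, Measurable f →
    ∫⁻ y, ∫⁻ u in C, (windowMass T μ ρ C y u)⁻¹ *
        ∫⁻ v, C.indicator 1 (v + u) * f (T v y, v + u) * ρ (T v y) ∂μ ∂μ ∂Q
      = ∫⁻ y, ∫⁻ u in C, f (y, u) ∂μ ∂Q

/-- The symmetric, denominator-free form of mass-stationarity. -/
def WindowExchange (T : MeasurableFlow V Y) (μ : Measure V) (ρ : Y → ℝ≥0)
    (Q : Measure Y) (C : Set V) : Prop :=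
  ∀ f : Y × V → ℝ≥0∞, Measurable f →
    ∫⁻ y, ∫⁻ u in C, ∫⁻ v, C.indicator 1 (v + u) * f (T v y, v + u) * ρ (T v y) ∂μ ∂μ ∂Q
      = ∫⁻ y, ∫⁻ u in C, ∫⁻ v, C.indicator 1 (v + u) * f (y, u) * ρ (T v y) ∂μ ∂μ ∂Q

variable {T : MeasurableFlow V Y} {μ : Measure V} [μ.IsAddHaarMeasure] {ρ : Y → ℝ≥0}

theorem measurable_windowMass (hρ : Measurable ρ) {C : Set V} (hC : MeasurableSet C) :
    Measurable (fun p : Y × V => windowMass T μ ρ C p.1 p.2) := by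
  have hi : Measurable (C.indicator (1 : V → ℝ≥0∞)) := measurable_one.indicator hC
  exact Measurable.lintegral_prod_right'
    (f := fun p : (Y × V) × V => C.indicator 1 (p.2 + p.1.2) * (ρ (T p.2 p.1.1) : ℝ≥0∞))
    (by fun_prop)

omit [NormedSpace ℝ V] [FiniteDimensional ℝ V] in
theorem windowMass_flow (C : Set V) (y : Y) (u v : V) :
    windowMass T μ ρ C (T v y) (v + u) = windowMass T μ ρ C y u := by
  rw [windowMass, windowMass, ← lintegral_add_right_eq_self
    (fun s => C.indicator 1 (s + u) * (ρ (T s y) : ℝ≥0∞)) v]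
  simp only [T.map_add, add_assoc]

/-- By `windowMass_flow` the window mass is the same at both ends of the exchange, so it can be
absorbed into the test function as a factor or as its inverse. -/
theorem flowMassStationary_iff (hρ : Measurable ρ) {Q : Measure Y}
    (h0 : ∀ C, IsJordan μ C → 0 < μ C → ∀ y u, windowMass T μ ρ C y u ≠ 0)
    (htop : ∀ C, IsJordan μ C → ∀ y u, windowMass T μ ρ C y u ≠ ∞) :
    FlowMassStationary T μ ρ Q ↔
      ∀ C, IsJordan μ C → 0 < μ C → WindowExchange T μ ρ Q C := by
  refine forall_congr' fun C => forall_congr' fun hC => forall_congr' fun hpos => ?_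
  have hM := measurable_windowMass (T := T) (μ := μ) hρ hC.measurableSet
  have hi : Measurable (C.indicator (1 : V → ℝ≥0∞)) := measurable_one.indicator hC.measurableSet
  have hR : ∀ (f : Y × V → ℝ≥0∞) y u,
      ∫⁻ v, C.indicator 1 (v + u) * f (y, u) * ρ (T v y) ∂μ
        = f (y, u) * windowMass T μ ρ C y u := by
    intro f y u
    rw [windowMass, ← lintegral_const_mul _ (by fun_prop)]
    refine lintegral_congr fun v => ?_
    ring
  have hL : ∀ (f : Y × V → ℝ≥0∞), Measurable f → ∀ y u,
      ∫⁻ v, C.indicator 1 (v + u) * (f (T v y, v + u) *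
          (windowMass T μ ρ C (T v y) (v + u))⁻¹) * ρ (T v y) ∂μ
        = (windowMass T μ ρ C y u)⁻¹ *
          ∫⁻ v, C.indicator 1 (v + u) * f (T v y, v + u) * ρ (T v y) ∂μ := by
    intro f hf y u
    rw [← lintegral_const_mul _ (by fun_prop)]
    refine lintegral_congr fun v => ?_
    rw [windowMass_flow]
    ring
  have hcancel : ∀ (c : ℝ≥0∞) y u,
      c * (windowMass T μ ρ C y u)⁻¹ * windowMass T μ ρ C y u = c := fun c y u => by
    rw [mul_assoc, ENNReal.inv_mul_cancel (h0 C hC hpos y u) (htop C hC y u), mul_one]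
  have hcancel' : ∀ (c : ℝ≥0∞) y u,
      c * windowMass T μ ρ C y u * (windowMass T μ ρ C y u)⁻¹ = c := fun c y u => by
    rw [mul_assoc, ENNReal.mul_inv_cancel (h0 C hC hpos y u) (htop C hC y u), mul_one]
  constructor
  · intro h f hf
    refine Eq.trans ?_ ((h (fun p => f p * windowMass T μ ρ C p.1 p.2) (by fun_prop)).trans ?_)
    · refine lintegral_congr fun y => lintegral_congr fun u => ?_
      rw [← hL (fun p => f p * windowMass T μ ρ C p.1 p.2) (by fun_prop)]
      simp only [hcancel']
    · exact lintegral_congr fun y => lintegral_congr fun u => (hR f y u).symm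
  · intro h f hf
    refine Eq.trans ?_
      ((h (fun p => f p * (windowMass T μ ρ C p.1 p.2)⁻¹) (by fun_prop)).trans ?_)
    · exact lintegral_congr fun y => lintegral_congr fun u => (hL f hf y u).symm
    · exact lintegral_congr fun y => lintegral_congr fun u =>
        (hR (fun p => f p * (windowMass T μ ρ C p.1 p.2)⁻¹) y u).trans (hcancel _ y u)

/-- For fixed `u` the Mecke equation is applied to the right side; the substitution `u ↦ v + u` then
exchanges the two conditions of lying in `C`. -/
theorem Mecke.windowExchange (hρ : Measurable ρ) {Q : Measure Y} [SFinite Q]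
    (hQ : Mecke T μ ρ Q) {C : Set V} (hC : MeasurableSet C) : WindowExchange T μ ρ Q C := by
  intro f hf
  have hi : Measurable (C.indicator (1 : V → ℝ≥0∞)) := measurable_one.indicator hC
  have e : ∀ G : Y × V × V → ℝ≥0∞, Measurable G →
      ∫⁻ y, ∫⁻ u in C, ∫⁻ v, G (y, u, v) ∂μ ∂μ ∂Q
        = ∫⁻ u, ∫⁻ y, ∫⁻ v, C.indicator 1 u * G (y, u, v) ∂μ ∂Q ∂μ := by
    intro G hG
    rw [lintegral_lintegral_swap (by
      refine Measurable.aemeasurable ?_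
      exact Measurable.lintegral_prod_right'
        (f := fun p : (Y × V) × V => G (p.1.1, p.1.2, p.2)) (by fun_prop)),
      ← lintegral_indicator hC]
    refine lintegral_congr fun u => ?_
    by_cases hu : u ∈ C <;> simp [hu]
  have e1 := e (fun p => C.indicator 1 (p.2.2 + p.2.1) *
    f (T p.2.2 p.1, p.2.2 + p.2.1) * ρ (T p.2.2 p.1)) (by fun_prop)
  have e2 := e (fun p => C.indicator 1 (p.2.2 + p.2.1) *
    f (p.1, p.2.1) * ρ (T p.2.2 p.1)) (by fun_prop)
  simp only at e1 e2
  rw [e1, e2]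
  have h2 : ∀ u, ∫⁻ y, ∫⁻ v, C.indicator 1 u * (C.indicator 1 (v + u) * f (y, u) * ρ (T v y))
        ∂μ ∂Q
      = ∫⁻ y, ∫⁻ v, C.indicator 1 u * (C.indicator 1 (-v + u) * f (T v y, u) * ρ (T v y))
        ∂μ ∂Q := by
    intro u
    have := hQ (fun p => C.indicator 1 u * (C.indicator 1 (p.2 + u) * f (p.1, u))) (by fun_prop)
    simpa only [mul_assoc] using this
  rw [lintegral_congr h2]
  have sw : ∀ G : V × Y × V → ℝ≥0∞, Measurable G →
      ∫⁻ u, ∫⁻ y, ∫⁻ v, G (u, y, v) ∂μ ∂Q ∂μ = ∫⁻ y, ∫⁻ v, ∫⁻ u, G (u, y, v) ∂μ ∂μ ∂Q := by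
    intro G hG
    rw [lintegral_lintegral_swap (by
      refine Measurable.aemeasurable ?_
      exact Measurable.lintegral_prod_right'
        (f := fun p : (V × Y) × V => G (p.1.1, p.1.2, p.2)) (by fun_prop))]
    refine lintegral_congr fun y => ?_
    rw [lintegral_lintegral_swap (by fun_prop)]
  have s1 := sw (fun p => C.indicator 1 p.1 * (C.indicator 1 (p.2.2 + p.1) *
    f (T p.2.2 p.2.1, p.2.2 + p.1) * ρ (T p.2.2 p.2.1))) (by fun_prop)
  have s2 := sw (fun p => C.indicator 1 p.1 * (C.indicator 1 (-p.2.2 + p.1) *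
    f (T p.2.2 p.2.1, p.1) * ρ (T p.2.2 p.2.1))) (by fun_prop)
  simp only at s1 s2
  rw [s1, s2]
  refine lintegral_congr fun y => lintegral_congr fun v => ?_
  conv_rhs => rw [← lintegral_add_left_eq_self _ v]
  refine lintegral_congr fun u => ?_
  rw [neg_add_cancel_left]
  ring

/-- The Campbell measure of the random measure with density `s ↦ ρ (T s y)`. -/
noncomputable def campbell (T : MeasurableFlow V Y) (μ : Measure V) (ρ : Y → ℝ≥0)
    (Q : Measure Y) : Measure (Y × V) :=
  (Q.prod μ).withDensity (fun p => (ρ (T p.2 p.1) : ℝ≥0∞))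

omit [BorelSpace V] in
theorem lintegral_campbell (hρ : Measurable ρ) {Q : Measure Y} [SFinite Q]
    {F : Y × V → ℝ≥0∞} (hF : Measurable F) :
    ∫⁻ p, F p ∂(campbell T μ ρ Q) = ∫⁻ y, ∫⁻ s, F (y, s) * ρ (T s y) ∂μ ∂Q := by
  rw [campbell, lintegral_withDensity_eq_lintegral_mul _ (by fun_prop) hF,
    lintegral_prod _ (by fun_prop)]
  simp [mul_comm]

instance (T : MeasurableFlow V Y) (ρ : Y → ℝ≥0) (Q : Measure Y) [SFinite Q] :
    SFinite (campbell T μ ρ Q) := by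
  unfold campbell
  infer_instance

/-- The sum map sending `((y, v), w)` to `((y, w), w + v)`. -/
def windowMap (p : (Y × V) × V) : (Y × V) × V := ((p.1.1, p.2), p.2 + p.1.2)

theorem measurable_windowMap : Measurable (windowMap : (Y × V) × V → (Y × V) × V) := by
  unfold windowMap
  fun_prop

/-- `windowMap` has a measurable left inverse, and the factor `μ` cancels on a ball of positive
finite measure. -/
theorem eq_of_map_windowMap_eq {K K' : Measure (Y × V)} [SFinite K] [SFinite K']
    (h : (K.prod μ).map windowMap = (K'.prod μ).map windowMap) : K = K' := by
  set R : (Y × V) × V → (Y × V) × V := fun p => ((p.1.1, p.2 - p.1.2), p.1.2) with hR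
  have hRm : Measurable R := by fun_prop
  have hRw : R ∘ windowMap = id := by
    funext p
    simp [hR, windowMap]
  have h2 : K.prod μ = K'.prod μ := by
    have := congrArg (Measure.map R) h
    rwa [Measure.map_map hRm measurable_windowMap, Measure.map_map hRm measurable_windowMap,
      hRw, Measure.map_id, Measure.map_id] at this
  ext A hA
  have h3 := congrArg (fun L => L (A ×ˢ Metric.ball (0 : V) 1)) h2
  simp only [Measure.prod_prod] at h3
  exact (ENNReal.mul_left_inj (Metric.measure_ball_pos μ 0 one_pos).ne'
    measure_ball_lt_top.ne).1 h3

theorem lintegral_map_windowMap (K : Measure (Y × V)) {F : (Y × V) × V → ℝ≥0∞}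
    (hF : Measurable F) :
    ∫⁻ q, F q ∂((K.prod μ).map windowMap) = ∫⁻ p, ∫⁻ w, F ((p.1, w), w + p.2) ∂μ ∂K := by
  have := measurable_windowMap (V := V) (Y := Y)
  rw [lintegral_map hF measurable_windowMap, lintegral_prod _ (by fun_prop)]
  rfl

/-- The Mecke equation says that the Campbell measure equals its flip. After attaching a
`μ`-distributed point and applying `windowMap`, window exchange for `C` with `f = 1_D` is equality
of the two measures on `D ×ˢ C`, provided that `D ⊆ Y × C`. -/
theorem mecke_of_windowExchange [Nontrivial V] (hρ : Measurable ρ) {Q : Measure Y}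
    [SigmaFinite Q]
    (hfin : ∀ y r, ∫⁻ s in Metric.ball (0 : V) r, ρ (T s y) ∂μ ≠ ∞)
    (hQ : ∀ C, IsJordan μ C → 0 < μ C → WindowExchange T μ ρ Q C) : Mecke T μ ρ Q := by
  have hflip : Measurable (fun p : Y × V => (T p.2 p.1, -p.2)) := by fun_prop
  suffices h : campbell T μ ρ Q = (campbell T μ ρ Q).map (fun p : Y × V => (T p.2 p.1, -p.2)) by
    intro F hF
    rw [← lintegral_campbell hρ hF, ← lintegral_campbell hρ
      (F := fun p => F (T p.2 p.1, -p.2)) (by fun_prop)]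
    conv_lhs => rw [h]
    rw [lintegral_map hF hflip]
  apply eq_of_map_windowMap_eq (μ := μ)
  have hprod : ∀ (D : Set (Y × V)) (C : Set V) q, (D ×ˢ C).indicator (1 : (Y × V) × V → ℝ≥0∞) q
      = D.indicator 1 q.1 * C.indicator 1 q.2 := by
    intro D C q
    by_cases h1 : q.1 ∈ D <;> by_cases h2 : q.2 ∈ C <;> simp [Set.indicator, h1, h2]
  have hint : ∀ D C, MeasurableSet D → MeasurableSet C →
      ((campbell T μ ρ Q).prod μ).map windowMap (D ×ˢ C)
        = ∫⁻ y, ∫⁻ v, (∫⁻ u, D.indicator 1 (y, u) * C.indicator 1 (u + v) ∂μ) * ρ (T v y)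
          ∂μ ∂Q := by
    intro D C hD hC
    have hDi : Measurable (D.indicator (1 : Y × V → ℝ≥0∞)) := measurable_one.indicator hD
    have hCi : Measurable (C.indicator (1 : V → ℝ≥0∞)) := measurable_one.indicator hC
    rw [← lintegral_indicator_one (hD.prod hC), lintegral_map_windowMap _
      (measurable_one.indicator (hD.prod hC))]
    simp only [hprod]
    rw [lintegral_campbell hρ (F := fun p => ∫⁻ w, D.indicator 1 (p.1, w) *
      C.indicator 1 (w + p.2) ∂μ) (Measurable.lintegral_prod_right'
        (f := fun p : (Y × V) × V => D.indicator 1 (p.1.1, p.2) *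
          C.indicator 1 (p.2 + p.1.2)) (by fun_prop))]
  have hint' : ∀ D C, MeasurableSet D → MeasurableSet C →
      (((campbell T μ ρ Q).map (fun p : Y × V => (T p.2 p.1, -p.2))).prod μ).map windowMap
          (D ×ˢ C)
        = ∫⁻ y, ∫⁻ v, (∫⁻ u, D.indicator 1 (T v y, u) * C.indicator 1 (u + -v) ∂μ) * ρ (T v y)
          ∂μ ∂Q := by
    intro D C hD hC
    have hDi : Measurable (D.indicator (1 : Y × V → ℝ≥0∞)) := measurable_one.indicator hD
    have hCi : Measurable (C.indicator (1 : V → ℝ≥0∞)) := measurable_one.indicator hC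
    rw [← lintegral_indicator_one (hD.prod hC), lintegral_map_windowMap _
      (measurable_one.indicator (hD.prod hC))]
    simp only [hprod]
    have hm : Measurable (fun p : Y × V => ∫⁻ w, D.indicator 1 (p.1, w) *
      C.indicator (1 : V → ℝ≥0∞) (w + p.2) ∂μ) := Measurable.lintegral_prod_right'
        (f := fun p : (Y × V) × V => D.indicator 1 (p.1.1, p.2) *
          C.indicator 1 (p.2 + p.1.2)) (by fun_prop)
    rw [lintegral_map hm hflip, lintegral_campbell hρ (F := fun p : Y × V =>
      ∫⁻ w, D.indicator 1 (T p.2 p.1, w) * C.indicator 1 (w + -p.2) ∂μ) (hm.comp hflip)]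
  have hex : ∀ C, IsJordan μ C → WindowExchange T μ ρ Q C := by
    intro C hC
    rcases eq_zero_or_pos (μ C) with h | h
    · intro f hf
      simp only [setLIntegral_measure_zero _ _ h]
    · exact hQ C hC h
  -- The cover consists of sets of finite measure: `u` and `u + v` in the ball of radius `n` force
  -- `v` into the ball of radius `n + n`, whose random mass is bounded by `k` on the chosen set of
  -- states.
  refine Measure.ext_of_generateFrom_of_cover_subset
    (T := Set.range fun n : ℕ × ℕ =>
      ((spanningSets Q n.2 ∩ {y | ∫⁻ s in Metric.ball (0 : V) (n.1 + n.1), ρ (T s y) ∂μ ≤ n.2})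
        ×ˢ Metric.ball (0 : V) n.1) ×ˢ Metric.ball (0 : V) n.1)
    generateFrom_jordanRectangles (isPiSystem_jordanRectangles (μ := μ)) ?_
    (Set.countable_range _) ?_ ?_ ?_
  · rintro _ ⟨n, rfl⟩
    refine ⟨_, _, ?_, isJordan_ball _ _, fun p hp => hp.2, rfl⟩
    refine ((measurableSet_spanningSets Q _).inter ?_).prod measurableSet_ball
    exact measurableSet_le (Measurable.lintegral_prod_right'
      (f := fun p : Y × V => (ρ (T p.2 p.1) : ℝ≥0∞)) (by fun_prop)) measurable_const
  · refine Set.eq_univ_of_forall fun ⟨⟨y, w⟩, b⟩ => ?_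
    obtain ⟨n, hn⟩ := exists_nat_gt (max ‖w‖ ‖b‖)
    obtain ⟨k, hk⟩ := ENNReal.exists_nat_gt (hfin y (n + n))
    refine Set.mem_sUnion.2 ⟨_, ⟨(n, max k (spanningSetsIndex Q y)), rfl⟩, ⟨⟨?_, ?_⟩, ?_⟩, ?_⟩
    · exact monotone_spanningSets Q (le_max_right _ _) (mem_spanningSetsIndex Q y)
    · exact hk.le.trans (by exact_mod_cast le_max_left _ _)
    · simpa using (le_max_left _ _).trans_lt hn
    · simpa using (le_max_right _ _).trans_lt hn
  · rintro _ ⟨⟨n, k⟩, rfl⟩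
    have hm : Measurable fun y => ∫⁻ s in Metric.ball (0 : V) (n + n), (ρ (T s y) : ℝ≥0∞) ∂μ :=
      Measurable.lintegral_prod_right' (f := fun p : Y × V => (ρ (T p.2 p.1) : ℝ≥0∞))
        (by fun_prop)
    set A := spanningSets Q k ∩
      {y | ∫⁻ s in Metric.ball (0 : V) (n + n), ρ (T s y) ∂μ ≤ k} with hA
    have hAm : MeasurableSet A :=
      (measurableSet_spanningSets Q _).inter (measurableSet_le hm measurable_const)
    rw [hint _ _ (hAm.prod measurableSet_ball) measurableSet_ball]
    refine ne_top_of_le_ne_top (b := k * μ (Metric.ball (0 : V) n) * Q A) ?_ ?_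
    · exact ENNReal.mul_ne_top (ENNReal.mul_ne_top (by simp) measure_ball_lt_top.ne)
        ((measure_mono Set.inter_subset_left).trans_lt (measure_spanningSets_lt_top Q k)).ne
    have hb : ∀ y v, (∫⁻ u, (A ×ˢ Metric.ball (0 : V) n).indicator 1 (y, u) *
        (Metric.ball (0 : V) n).indicator 1 (u + v) ∂μ)
          ≤ A.indicator 1 y * (Metric.ball (0 : V) (n + n)).indicator 1 v
            * μ (Metric.ball (0 : V) n) := by
      intro y v
      rw [← lintegral_indicator_one measurableSet_ball,
        ← lintegral_const_mul _ (measurable_one.indicator measurableSet_ball)]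
      refine lintegral_mono fun u => ?_
      by_cases h1 : (y, u) ∈ A ×ˢ Metric.ball (0 : V) n
      · by_cases h2 : u + v ∈ Metric.ball (0 : V) n
        · have h3 : v ∈ Metric.ball (0 : V) (n + n) := by
            have h4 := h1.2
            rw [mem_ball_zero_iff] at h2 h4 ⊢
            have := norm_sub_le (u + v) u
            rw [add_sub_cancel_left] at this
            linarith
          simp [h1, h2, h3, h1.1, -Set.mem_prod, (h1.2 : u ∈ Metric.ball (0 : V) n),
            -Metric.mem_ball]
        · simp [h2, -Metric.mem_ball]
      · simp [h1, -Set.mem_prod]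
    calc _ ≤ ∫⁻ y, ∫⁻ v, (A.indicator 1 y * (Metric.ball (0 : V) (n + n)).indicator 1 v
            * μ (Metric.ball (0 : V) n)) * ρ (T v y) ∂μ ∂Q :=
          lintegral_mono fun y => lintegral_mono fun v => by gcongr; exact hb y v
      _ = ∫⁻ y, A.indicator (fun y => μ (Metric.ball (0 : V) n) *
            ∫⁻ s in Metric.ball (0 : V) (n + n), ρ (T s y) ∂μ) y ∂Q := by
          refine lintegral_congr fun y => ?_
          by_cases hy : y ∈ A
          · rw [Set.indicator_of_mem hy, Set.indicator_of_mem hy,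
              ← lintegral_indicator measurableSet_ball, ← lintegral_const_mul _ (by apply Measurable.indicator _ measurableSet_ball; fun_prop)]
            refine lintegral_congr fun v => ?_
            by_cases hv : v ∈ Metric.ball (0 : V) (n + n) <;>
              simp [hv, -Metric.mem_ball]
          · simp [hy]
      _ ≤ ∫⁻ y, A.indicator (fun _ => k * μ (Metric.ball (0 : V) n)) y ∂Q := by
          refine lintegral_mono fun y => Set.indicator_le_indicator' fun hy => ?_
          rw [mul_comm]
          exact mul_le_mul_left hy.2 _
      _ = k * μ (Metric.ball (0 : V) n) * Q A := by
          rw [lintegral_indicator_const hAm]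
  · rintro _ ⟨D, C, hD, hC, hDC, rfl⟩
    rw [hint D C hD hC.measurableSet, hint' D C hD hC.measurableSet]
    have hDi : Measurable (D.indicator (1 : Y × V → ℝ≥0∞)) := measurable_one.indicator hD
    have hCi : Measurable (C.indicator (1 : V → ℝ≥0∞)) :=
      measurable_one.indicator hC.measurableSet
    have hDC' : ∀ y u, C.indicator 1 u * D.indicator (1 : Y × V → ℝ≥0∞) (y, u)
        = D.indicator 1 (y, u) := by
      intro y u
      by_cases h : (y, u) ∈ D
      · have := hDC h
        simp_all
      · simp [h]
    have hsw : ∀ G : Y × V × V → ℝ≥0∞, Measurable G →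
        ∫⁻ y, ∫⁻ u in C, ∫⁻ v, G (y, u, v) ∂μ ∂μ ∂Q
          = ∫⁻ y, ∫⁻ v, ∫⁻ u, C.indicator 1 u * G (y, u, v) ∂μ ∂μ ∂Q := by
      intro G hG
      refine lintegral_congr fun y => ?_
      rw [lintegral_lintegral_swap (by fun_prop)]
      refine lintegral_congr fun v => ?_
      rw [← lintegral_indicator hC.measurableSet]
      refine lintegral_congr fun u => ?_
      by_cases hu : u ∈ C <;> simp [hu]
    have h := hex C hC (D.indicator 1) hDi
    rw [hsw (fun p => C.indicator 1 (p.2.2 + p.2.1) * D.indicator 1 (T p.2.2 p.1, p.2.2 + p.2.1)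
        * ρ (T p.2.2 p.1)) (by fun_prop),
      hsw (fun p => C.indicator 1 (p.2.2 + p.2.1) * D.indicator 1 (p.1, p.2.1)
        * ρ (T p.2.2 p.1)) (by fun_prop)] at h
    refine Eq.trans ?_ (h.symm.trans ?_)
    · refine lintegral_congr fun y => lintegral_congr fun v => ?_
      rw [← lintegral_mul_const _ (by fun_prop)]
      refine lintegral_congr fun u => ?_
      rw [add_comm u v]
      nth_rw 1 [← hDC' y u]
      ring
    · refine lintegral_congr fun y => lintegral_congr fun v => ?_
      rw [← lintegral_mul_const _ (by fun_prop)]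
      -- The substitution `u ↦ v + u` turns the flipped side into the left side of window exchange.
      conv_rhs => rw [← lintegral_add_left_eq_self _ v]
      refine lintegral_congr fun u => ?_
      rw [hDC', add_neg_cancel_comm]
      ring

omit [NormedSpace ℝ V] [FiniteDimensional ℝ V] in
theorem windowMass_ne_zero (hρ : Measurable ρ) (hpos : ∀ y, 0 < ρ y) {C : Set V}
    (hC : MeasurableSet C) (hC0 : 0 < μ C) (y : Y) (u : V) : windowMass T μ ρ C y u ≠ 0 := by
  have hi : Measurable (C.indicator (1 : V → ℝ≥0∞)) := measurable_one.indicator hC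
  intro h
  rw [windowMass, lintegral_eq_zero_iff (by fun_prop)] at h
  have h2 : μ ((fun v => v + u) ⁻¹' C) = 0 := by
    refine measure_mono_null (fun v (hv : v + u ∈ C) => ?_) h
    simp [hv, (hpos _).ne']
  rw [measure_preimage_add_right] at h2
  exact hC0.ne' h2

omit [NormedSpace ℝ V] [FiniteDimensional ℝ V] [μ.IsAddHaarMeasure] in
theorem windowMass_ne_top
    (hfin : ∀ y r, ∫⁻ s in Metric.ball (0 : V) r, ρ (T s y) ∂μ ≠ ∞) {C : Set V}
    (hC : Bornology.IsBounded C) (y : Y) (u : V) : windowMass T μ ρ C y u ≠ ∞ := by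
  obtain ⟨r, hr⟩ := hC.subset_ball u
  refine ne_top_of_le_ne_top (hfin y r) ?_
  rw [← lintegral_indicator measurableSet_ball]
  refine lintegral_mono fun v => ?_
  by_cases hv : v + u ∈ C
  · have h1 : v ∈ Metric.ball (0 : V) r := by simpa [dist_eq_norm] using hr hv
    simp [hv, h1, -Metric.mem_ball]
  · simp [hv]

/-- Mass-stationarity is equivalent to the Mecke equation. -/
theorem flowMassStationary_iff_mecke [Nontrivial V] (hρ : Measurable ρ) (hpos : ∀ y, 0 < ρ y)
    (hfin : ∀ y r, ∫⁻ s in Metric.ball (0 : V) r, ρ (T s y) ∂μ ≠ ∞) {Q : Measure Y}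
    [SigmaFinite Q] : FlowMassStationary T μ ρ Q ↔ Mecke T μ ρ Q := by
  rw [flowMassStationary_iff hρ
    (fun C hC h y u => windowMass_ne_zero hρ hpos hC.measurableSet h y u)
    (fun C hC y u => windowMass_ne_top hfin hC.isBounded y u)]
  exact ⟨mecke_of_windowExchange hρ hfin, fun h C hC _ => h.windowExchange hρ hC.measurableSet⟩

end Stationarity

/-! ### Shift flows on invariant sets of paths. -/

section Paths

variable {d : ℕ} {H : PathSpace d} (S : Set H.paths)
  (hS : ∀ (t : Space d), ∀ z ∈ S, t +ᵥ z ∈ S)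

theorem PathSpace.measurable_vadd (H : PathSpace d) :
    Measurable (fun p : Space d × H.paths => p.1 +ᵥ p.2) :=
  H.measurable_shift

instance (H : PathSpace d) : MeasurableVAdd₂ (Space d) H.paths where
  measurable_vadd := H.measurable_vadd

/-- The shift flow on a shift-invariant set of paths. -/
def pathFlow : MeasurableFlow (Space d) S where
  toFun t z := ⟨t +ᵥ z.1, hS t z.1 z.2⟩
  map_zero _ := Subtype.ext (zero_vadd _ _)
  map_add s t z := Subtype.ext (add_vadd s t z.1)
  measurable_uncurry := Measurable.subtype_mk
    (H.measurable_vadd.comp (measurable_fst.prodMk (measurable_subtype_coe.comp measurable_snd)))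

/-- The value of a path at the origin. -/
def originDensity (z : S) : ℝ≥0 := (z.1 : Space d → ℝ≥0) 0

@[fun_prop]
theorem measurable_originDensity : Measurable (originDensity S) :=
  (measurable_pi_apply 0).comp (measurable_subtype_coe.comp measurable_subtype_coe)

theorem originDensity_pathFlow (s : Space d) (z : S) :
    originDensity S (pathFlow S hS s z) = (z.1 : Space d → ℝ≥0) s := by
  rw [originDensity, pathFlow]
  change (z.1 : Space d → ℝ≥0) (s + 0) = _
  rw [add_zero]

/-- The shift flow on pairs of a state and a path. -/
def pairFlow {E : Type*} [MeasurableSpace E] [AddAction (Space d) E]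
    (hE : Measurable (fun p : Space d × E => p.1 +ᵥ p.2)) :
    MeasurableFlow (Space d) (E × S) where
  toFun t y := (t +ᵥ y.1, pathFlow S hS t y.2)
  map_zero y := by rw [zero_vadd, MeasurableFlow.map_zero]
  map_add s t y := by rw [add_vadd, MeasurableFlow.map_add]
  measurable_uncurry := by
    refine Measurable.prodMk ?_
      ((pathFlow S hS).measurable measurable_fst (measurable_snd.comp measurable_snd))
    exact hE.comp (measurable_fst.prodMk (measurable_fst.comp measurable_snd))

/-- The random measure with density given by a path. -/
noncomputable def pathMeasure (z : H.paths) : Measure (Space d) :=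
  volume.withDensity (fun s => ((z : Space d → ℝ≥0) s : ℝ≥0∞))

theorem measurable_path_eval :
    Measurable (fun p : H.paths × Space d => (p.1 : Space d → ℝ≥0) p.2) := by
  have h : (fun p : H.paths × Space d => (p.1 : Space d → ℝ≥0) p.2)
      = fun p => ((p.2 +ᵥ p.1 : H.paths) : Space d → ℝ≥0) 0 := by
    funext p
    rw [H.vadd_apply, add_zero]
  rw [h]
  exact (measurable_pi_apply 0).comp (measurable_subtype_coe.comp
    (H.measurable_vadd.comp measurable_swap))

@[fun_prop]
theorem measurable_path (z : H.paths) : Measurable (z : Space d → ℝ≥0) :=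
  measurable_path_eval.comp (measurable_const.prodMk measurable_id)

@[fun_prop]
theorem measurable_pathMeasure : Measurable (pathMeasure (H := H)) := by
  refine Measure.measurable_of_measurable_coe _ fun B hB => ?_
  simp only [pathMeasure, withDensity_apply _ hB]
  have := measurable_path_eval (H := H)
  exact Measurable.lintegral_prod_right'
    (f := fun p : H.paths × Space d => ((p.1 : Space d → ℝ≥0) p.2 : ℝ≥0∞)) (by fun_prop)

theorem pathMeasure_vadd (t : Space d) (z : H.paths) :
    pathMeasure (t +ᵥ z) = shiftMeasure t (pathMeasure z) := by
  ext B hB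
  have hm : MeasurableSet ((fun s => s - t) ⁻¹' B) := measurable_sub_const t hB
  rw [shiftMeasure, Measure.map_apply (measurable_sub_const t) hB, pathMeasure, pathMeasure,
    withDensity_apply _ hB, withDensity_apply _ hm, ← lintegral_indicator hB,
    ← lintegral_indicator hm]
  conv_rhs => rw [← lintegral_add_left_eq_self _ t]
  refine lintegral_congr fun s => ?_
  have : t + s ∈ (fun s => s - t) ⁻¹' B ↔ s ∈ B := by simp
  by_cases hs : s ∈ B
  · rw [Set.indicator_of_mem hs, Set.indicator_of_mem (this.2 hs), H.vadd_apply]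
  · rw [Set.indicator_of_notMem hs, Set.indicator_of_notMem (mt this.1 hs)]

theorem lintegral_pathMeasure (z : H.paths) {f : Space d → ℝ≥0∞} (hf : Measurable f) :
    ∫⁻ s, f s ∂(pathMeasure z) = ∫⁻ s, f s * (z : Space d → ℝ≥0) s := by
  rw [pathMeasure, lintegral_withDensity_eq_lintegral_mul _ (by fun_prop) hf]
  simp [mul_comm]

/-- A pair of a state and a path of `S`, regarded in the full space of pairs. -/
def pairVal {E : Type*} (y : E × S) : E × H.paths := (y.1, y.2.1)

theorem measurable_pairVal {E : Type*} [MeasurableSpace E] :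
    Measurable (pairVal S : E × S → E × H.paths) :=
  measurable_fst.prodMk (measurable_subtype_coe.comp measurable_snd)

theorem le_comap_pairVal {E : Type*} [MeasurableSpace E] :
    (inferInstance : MeasurableSpace (E × S))
      ≤ MeasurableSpace.comap (pairVal S) inferInstance := by
  refine sup_le ?_ ?_
  · rintro _ ⟨A, hA, rfl⟩
    exact ⟨Prod.fst ⁻¹' A, measurable_fst hA, rfl⟩
  · rintro _ ⟨_, ⟨A, hA, rfl⟩, rfl⟩
    exact ⟨Prod.snd ⁻¹' A, measurable_snd hA, rfl⟩

/-- The σ-algebra on `E × S` is pulled back from `E × H.paths`, so measurability of `S` plays no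
role. -/
theorem map_pairVal_injective {E : Type*} [MeasurableSpace E] {Q Q' : Measure (E × S)}
    (h : Q.map (pairVal S) = Q'.map (pairVal S)) : Q = Q' := by
  ext A hA
  obtain ⟨B, hB, rfl⟩ := le_comap_pairVal S A hA
  rw [← Measure.map_apply (measurable_pairVal S) hB, h,
    Measure.map_apply (measurable_pairVal S) hB]

/-- A measurable function of a pair with path in `S` and a location is the restriction of
a measurable function of the full pair, its random measure and the location. -/
theorem exists_measurable_extension {E : Type*} [MeasurableSpace E]
    {f : (E × S) × Space d → ℝ≥0∞} (hf : Measurable f) :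
    ∃ g : ((E × H.paths) × Measure (Space d)) × Space d → ℝ≥0∞, Measurable g ∧
      ∀ y u, g ((pairVal S y, pathMeasure y.2.1), u) = f (y, u) := by
  have hle : (inferInstance : MeasurableSpace ((E × S) × Space d))
      ≤ MeasurableSpace.comap (fun p : (E × S) × Space d => (pairVal S p.1, p.2))
        inferInstance := by
    refine sup_le ?_ ?_
    · rintro _ ⟨A, hA, rfl⟩
      obtain ⟨B, hB, rfl⟩ := le_comap_pairVal S A hA
      exact ⟨Prod.fst ⁻¹' B, measurable_fst hB, rfl⟩
    · rintro _ ⟨A, hA, rfl⟩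
      exact ⟨Prod.snd ⁻¹' A, measurable_snd hA, rfl⟩
  obtain ⟨g, hg, rfl⟩ := (hf.mono hle le_rfl).exists_eq_measurable_comp
  exact ⟨fun q => g (q.1.1, q.2), by fun_prop, fun y u => rfl⟩

end Paths

/-! ### The orbit space of the field. -/

section Orbits

variable {d : ℕ} {Ω : Type*} {H : PathSpace d} (Z : Ω → H.paths)

/-- The paths of the field `Z` and all their shifts. -/
def orbits : Set H.paths := {z | ∃ (t : Space d) (ω : Ω), z = t +ᵥ Z ω}

theorem vadd_mem_orbits (t : Space d) (z : H.paths) (hz : z ∈ orbits Z) :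
    t +ᵥ z ∈ orbits Z := by
  obtain ⟨s, ω, rfl⟩ := hz
  exact ⟨t + s, ω, (add_vadd t s (Z ω)).symm⟩

/-- The field `Z` as a random element of its orbit space. -/
def orbitField (ω : Ω) : orbits Z := ⟨Z ω, 0, ω, (zero_vadd _ _).symm⟩

/-- The shift flow on the orbits of the field. -/
abbrev orbitFlow : MeasurableFlow (Space d) (orbits Z) := pathFlow (orbits Z) (vadd_mem_orbits Z)

variable {Z}

theorem originDensity_pos (hpos : ∀ ω (s : Space d), 0 < (Z ω : Space d → ℝ≥0) s)
    (z : orbits Z) : 0 < originDensity (orbits Z) z := by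
  obtain ⟨_, t, ω, rfl⟩ := z
  exact hpos ω _

theorem isLineDensity_orbit
    (hpos : ∀ ω (s : Space d), 0 < (Z ω : Space d → ℝ≥0) s)
    (hline : ∀ ω (x u : Space d), u ≠ 0 →
      LocallyIntegrable (fun a : ℝ => ((Z ω : Space d → ℝ≥0) (x + a • u) : ℝ)) volume)
    (hhalf : ∀ ω (x u : Space d), u ≠ 0 →
      ∫⁻ a in Set.Ici (0 : ℝ), ((Z ω : Space d → ℝ≥0) (x + a • u) : ℝ≥0∞) = ⊤)
    {u : Space d} (hu : u ≠ 0) (z : orbits Z) :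
    IsLineDensity (fun a => originDensity (orbits Z) ((orbitFlow Z).line u a z)) := by
  have hm := measurable_originDensity (orbits Z)
  have he : ∀ a, originDensity (orbits Z) ((orbitFlow Z).line u a z)
      = (z.1 : Space d → ℝ≥0) (a • u) := fun a =>
    originDensity_pathFlow _ (vadd_mem_orbits Z) _ _
  refine ⟨by fun_prop, fun a => originDensity_pos hpos _, ?_, ?_, ?_⟩
  all_goals
    simp only [he]
    obtain ⟨_, t, ω, rfl⟩ := z
    simp only [H.vadd_apply]
  · exact hline ω t u hu
  · exact hhalf ω t u hu
  -- The negative half-line in direction `u` is the positive one in direction `-u`.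
  · rw [← hhalf ω t (-u) (neg_ne_zero.2 hu), ← lintegral_indicator measurableSet_Iic,
      ← lintegral_indicator measurableSet_Ici, ← lintegral_neg_eq_self]
    refine lintegral_congr fun a => ?_
    simp [Set.indicator]

theorem lintegral_ball_orbit_ne_top
    {ξ : Ω → Measure (Space d)} (hξ : ∀ ω, IsLocallyFiniteMeasure (ξ ω))
    (hdens : ∀ ω, ξ ω = pathMeasure (Z ω)) (z : orbits Z) (r : ℝ) :
    ∫⁻ s in Metric.ball (0 : Space d) r, originDensity (orbits Z) (orbitFlow Z s z) ≠ ∞ := by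
  simp only [originDensity_pathFlow]
  obtain ⟨_, t, ω, rfl⟩ := z
  have h : pathMeasure (t +ᵥ Z ω) (Metric.ball 0 r) = ξ ω (Metric.ball t r) := by
    rw [pathMeasure_vadd, ← hdens, shiftMeasure, Measure.map_apply (measurable_sub_const t)
      measurableSet_ball]
    congr 1
    ext s
    simp [dist_eq_norm]
  rw [pathMeasure, withDensity_apply _ measurableSet_ball] at h
  rw [h]
  have := hξ ω
  exact measure_ball_lt_top.ne

/-- A preserving shift for `Z` preserves the random measures of all paths in the orbits. -/
theorem lintegral_allocation_orbit {π : H.paths → Space d} (hπ : Measurable π)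
    (hpres : ∀ ω, ∀ B : Set (Space d), MeasurableSet B →
      pathMeasure (Z ω) {s | allocation π (Z ω) s ∈ B} = pathMeasure (Z ω) B)
    (z : orbits Z) {g : Space d → ℝ≥0∞} (hg : Measurable g) :
    ∫⁻ s, g (s + π (s +ᵥ z.1)) * (z.1 : Space d → ℝ≥0) s
      = ∫⁻ s, g s * (z.1 : Space d → ℝ≥0) s := by
  obtain ⟨_, t, ω, rfl⟩ := z
  have hv : Measurable (fun s : Space d => s +ᵥ Z ω) :=
    H.measurable_vadd.comp (measurable_id.prodMk measurable_const)
  have hτ : Measurable (allocation π (Z ω)) := by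
    unfold allocation
    fun_prop
  have hmap : (pathMeasure (Z ω)).map (allocation π (Z ω)) = pathMeasure (Z ω) := by
    ext B hB
    rw [Measure.map_apply hτ hB]
    exact hpres ω B hB
  have h := lintegral_map (f := fun s => g (s - t)) (μ := pathMeasure (Z ω)) (by fun_prop) hτ
  rw [hmap, lintegral_pathMeasure _ (by fun_prop), lintegral_pathMeasure _ (by fun_prop)] at h
  rw [← lintegral_add_left_eq_self _ t] at h
  conv_rhs at h => rw [← lintegral_add_left_eq_self _ t]
  refine Eq.trans ?_ (h.symm.trans ?_)
  · refine lintegral_congr fun s => ?_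
    rw [H.vadd_apply, ← add_vadd, add_comm s t, allocation]
    congr 2
    abel
  · refine lintegral_congr fun s => ?_
    rw [H.vadd_apply, add_sub_cancel_left]

end Orbits

/-! ### Transfer between `Ω` and the orbit space. -/

section Transfer

variable {d : ℕ} {Ω : Type*} [MeasurableSpace Ω] {P : Measure Ω}
  {E : Type*} [MeasurableSpace E] [AddAction (Space d) E]
  (hE : Measurable (fun p : Space d × E => p.1 +ᵥ p.2))
  {X : Ω → E} (hX : Measurable X) {H : PathSpace d} {Z : Ω → H.paths} (hZ : Measurable Z)

theorem measurable_orbitField {Z : Ω → H.paths} (hZ : Measurable Z) :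
    Measurable (orbitField Z) := Measurable.subtype_mk hZ

/-- The shift flow on pairs of a state and a path in the orbits of the field. -/
abbrev stateFlow (Z : Ω → H.paths) : MeasurableFlow (Space d) (E × orbits Z) :=
  pairFlow (orbits Z) (vadd_mem_orbits Z) hE

/-- The density at the origin as a function of a pair. -/
abbrev stateDensity (E : Type*) (Z : Ω → H.paths) (y : E × orbits Z) : ℝ≥0 :=
  originDensity (orbits Z) y.2

/-- The distribution of `(X, Z)` on the orbit space. -/
noncomputable abbrev stateLaw (P : Measure Ω) (X : Ω → E) (Z : Ω → H.paths) :
    Measure (E × orbits Z) := P.map (fun ω => (X ω, orbitField Z ω))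

include hX hZ

theorem lintegral_window {ξ : Ω → Measure (Space d)} (hdens : ∀ ω, ξ ω = pathMeasure (Z ω))
    {C : Set (Space d)} (hC : MeasurableSet C)
    {f : ((E × H.paths) × Measure (Space d)) × Space d → ℝ≥0∞} (hf : Measurable f) :
    ∫⁻ ω, ∫⁻ u, ∫⁻ v, f (((v +ᵥ X ω, v +ᵥ Z ω), shiftMeasure v (ξ ω)), v + u)
          ∂(cond (ξ ω) ((fun y => y - u) '' C)) ∂(cond volume C) ∂P
      = (volume C)⁻¹ * ∫⁻ y, ∫⁻ u in C, (windowMass (stateFlow hE Z) volume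
          (stateDensity E Z) C y u)⁻¹ * ∫⁻ v, C.indicator 1 (v + u) *
            f ((pairVal (orbits Z) (stateFlow hE Z v y),
              pathMeasure (stateFlow hE Z v y).2.1), v + u) *
            stateDensity E Z (stateFlow hE Z v y) ∂volume ∂volume ∂(stateLaw P X Z) := by
  have hXZ : Measurable (fun ω => (X ω, orbitField Z ω)) :=
    hX.prodMk (measurable_orbitField hZ)
  have hρ : Measurable (stateDensity E Z) := (measurable_originDensity _).comp measurable_snd
  have hEv : MeasurableVAdd₂ (Space d) E := ⟨hE⟩
  have hpv := measurable_pairVal (E := E) (orbits Z)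
  have hi : Measurable (C.indicator (1 : Space d → ℝ≥0∞)) := measurable_one.indicator hC
  have hM := measurable_windowMass (T := stateFlow hE Z) (μ := volume) hρ hC
  have hin : Measurable fun p : (E × orbits Z) × Space d => ∫⁻ v, C.indicator 1 (v + p.2) *
            f ((pairVal (orbits Z) (stateFlow hE Z v p.1),
              pathMeasure (stateFlow hE Z v p.1).2.1), v + p.2) *
            stateDensity E Z (stateFlow hE Z v p.1) :=
    Measurable.lintegral_prod_right' (f := fun q : ((E × orbits Z) × Space d) × Space d =>
      C.indicator 1 (q.2 + q.1.2) * f ((pairVal (orbits Z) (stateFlow hE Z q.2 q.1.1),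
        pathMeasure (stateFlow hE Z q.2 q.1.1).2.1), q.2 + q.1.2) *
          (stateDensity E Z (stateFlow hE Z q.2 q.1.1) : ℝ≥0∞)) (by fun_prop)
  have hout : Measurable fun y : E × orbits Z => ∫⁻ u in C, (windowMass (stateFlow hE Z) volume
          (stateDensity E Z) C y u)⁻¹ * ∫⁻ v, C.indicator 1 (v + u) *
            f ((pairVal (orbits Z) (stateFlow hE Z v y),
              pathMeasure (stateFlow hE Z v y).2.1), v + u) *
            stateDensity E Z (stateFlow hE Z v y) :=
    Measurable.lintegral_prod_right' (f := fun p : (E × orbits Z) × Space d =>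
      (windowMass (stateFlow hE Z) volume (stateDensity E Z) C p.1 p.2)⁻¹ *
        ∫⁻ v, C.indicator 1 (v + p.2) *
            f ((pairVal (orbits Z) (stateFlow hE Z v p.1),
              pathMeasure (stateFlow hE Z v p.1).2.1), v + p.2) *
            stateDensity E Z (stateFlow hE Z v p.1)) (by fun_prop)
  rw [stateLaw, ← lintegral_const_mul _ hout, lintegral_map (by fun_prop) hXZ]
  refine lintegral_congr fun ω => ?_
  rw [ProbabilityTheory.cond, lintegral_smul_measure, smul_eq_mul]
  congr 1
  refine lintegral_congr fun u => ?_
  have himg : (fun y => y - u) '' C = (fun v => v + u) ⁻¹' C := by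
    ext v
    simp [sub_eq_iff_eq_add]
  have hCu : MeasurableSet ((fun v => v + u) ⁻¹' C) := measurable_add_const u hC
  have hind : ∀ v, ((fun v => v + u) ⁻¹' C).indicator (1 : Space d → ℝ≥0∞) v
      = C.indicator 1 (v + u) := fun v => rfl
  have hd : ∀ v, stateDensity E Z (stateFlow hE Z v (X ω, orbitField Z ω))
      = (Z ω : Space d → ℝ≥0) v := fun v =>
    originDensity_pathFlow _ (vadd_mem_orbits Z) _ _
  have hw : (ξ ω) ((fun v => v + u) ⁻¹' C)
      = windowMass (stateFlow hE Z) volume (stateDensity E Z) C (X ω, orbitField Z ω) u := by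
    rw [hdens, ← lintegral_indicator_one hCu,
      lintegral_pathMeasure _ (measurable_one.indicator hCu), windowMass]
    simp only [hd, hind]
  rw [himg, ProbabilityTheory.cond, lintegral_smul_measure, smul_eq_mul, hw]
  congr 1
  have hg : Measurable fun v => f ((pairVal (orbits Z) (stateFlow hE Z v (X ω, orbitField Z ω)),
      pathMeasure (stateFlow hE Z v (X ω, orbitField Z ω)).2.1), v + u) := by
    fun_prop
  have hs : ∀ v, f (((v +ᵥ X ω, v +ᵥ Z ω), shiftMeasure v (ξ ω)), v + u)
      = f ((pairVal (orbits Z) (stateFlow hE Z v (X ω, orbitField Z ω)),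
      pathMeasure (stateFlow hE Z v (X ω, orbitField Z ω)).2.1), v + u) := by
    intro v
    rw [hdens, ← pathMeasure_vadd]
    rfl
  simp only [hs]
  rw [← lintegral_indicator hCu, hdens, lintegral_pathMeasure _ (hg.indicator hCu)]
  refine lintegral_congr fun v => ?_
  rw [hd, ← hind]
  by_cases hv : v ∈ (fun v => v + u) ⁻¹' C
  · rw [Set.indicator_of_mem hv, Set.indicator_of_mem hv, Pi.one_apply, one_mul]
  · rw [Set.indicator_of_notMem hv, Set.indicator_of_notMem hv, zero_mul, zero_mul, zero_mul]

theorem massStationary_iff {ξ : Ω → Measure (Space d)}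
    (hdens : ∀ ω, ξ ω = pathMeasure (Z ω)) :
    MassStationary P (fun ω => (X ω, Z ω)) ξ ↔
      FlowMassStationary (stateFlow hE Z) volume (stateDensity E Z) (stateLaw P X Z) := by
  have hXZ : Measurable (fun ω => (X ω, orbitField Z ω)) :=
    hX.prodMk (measurable_orbitField hZ)
  have hEv : MeasurableVAdd₂ (Space d) E := ⟨hE⟩
  have hpv := measurable_pairVal (E := E) (orbits Z)
  have hR : ∀ (C : Set (Space d)) (f : ((E × H.paths) × Measure (Space d)) × Space d → ℝ≥0∞),
      Measurable f → ∫⁻ ω, ∫⁻ u, f (((X ω, Z ω), ξ ω), u) ∂(cond volume C) ∂P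
        = (volume C)⁻¹ * ∫⁻ y, ∫⁻ u in C, f ((pairVal (orbits Z) y, pathMeasure y.2.1), u)
          ∂volume ∂(stateLaw P X Z) := by
    intro C f hf
    have hm : Measurable fun y : E × orbits Z =>
        ∫⁻ u in C, f ((pairVal (orbits Z) y, pathMeasure y.2.1), u) :=
      Measurable.lintegral_prod_right' (f := fun p : (E × orbits Z) × Space d =>
        f ((pairVal (orbits Z) p.1, pathMeasure p.1.2.1), p.2)) (by fun_prop)
    rw [stateLaw, ← lintegral_const_mul _ hm, lintegral_map (by fun_prop) hXZ]
    refine lintegral_congr fun ω => ?_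
    rw [ProbabilityTheory.cond, lintegral_smul_measure, smul_eq_mul, hdens]
    rfl
  constructor
  · intro h C hC hpos f hf
    obtain ⟨g, hg, hgf⟩ := exists_measurable_extension (orbits Z) hf
    have h1 := (lintegral_window hE hX hZ hdens hC.measurableSet hg).symm.trans
      ((h C hC.measurableSet hC.isBounded hpos hC.frontier g hg).trans (hR C g hg))
    simp only [hgf] at h1
    -- The normalisation of the uniform distribution cancels because `C` has positive finite volume.
    exact (ENNReal.mul_right_inj (ENNReal.inv_ne_zero.2 hC.isBounded.measure_lt_top.ne)
      (ENNReal.inv_ne_top.2 hpos.ne')).1 h1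
  · intro h C hC hb hpos hfr f hf
    refine (lintegral_window hE hX hZ hdens hC hf).trans (Eq.trans ?_ (hR C f hf).symm)
    congr 1
    exact h C ⟨hC, hb, hfr⟩ hpos (fun p => f ((pairVal (orbits Z) p.1, pathMeasure p.1.2.1), p.2))
      (by fun_prop)

theorem invariant_of_mecke {ξ : Ω → Measure (Space d)}
    (hdens : ∀ ω, ξ ω = pathMeasure (Z ω))
    (hpos : ∀ ω (s : Space d), 0 < (Z ω : Space d → ℝ≥0) s)
    (hξ : ∀ ω, IsLocallyFiniteMeasure (ξ ω))
    (hQ : Mecke (stateFlow hE Z) volume (stateDensity E Z) (stateLaw P X Z)) :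
    InvariantUnderPreservingShifts P X Z ξ := by
  intro π ⟨hπ, hpres⟩
  have hρ : Measurable (stateDensity E Z) :=
    (measurable_originDensity _).comp measurable_snd
  have hXZ : Measurable (fun ω => (X ω, orbitField Z ω)) :=
    hX.prodMk (measurable_orbitField hZ)
  have hEv : MeasurableVAdd₂ (Space d) E := ⟨hE⟩
  have hpv := measurable_pairVal (E := E) (orbits Z)
  have hπ' : Measurable fun y : E × orbits Z => π y.2.1 := by fun_prop
  have h := hQ.map_eq hρ (B := Metric.ball 0 1) measurableSet_ball
    (fun y => by
      have := windowMass_ne_zero (T := stateFlow hE Z) (μ := volume) hρ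
        (fun y => originDensity_pos hpos y.2) (C := Metric.ball 0 1) measurableSet_ball
        (Metric.measure_ball_pos _ _ one_pos) y 0
      rw [windowMass] at this
      convert this using 1
      rw [← lintegral_indicator measurableSet_ball]
      refine lintegral_congr fun s => ?_
      by_cases hs : s ∈ Metric.ball (0 : Space d) 1 <;> simp [hs, -Metric.mem_ball])
    (fun y => lintegral_ball_orbit_ne_top hξ hdens y.2 1)
    (π := fun y => π y.2.1) hπ'
    (fun y g hg => by
      have := lintegral_allocation_orbit hπ
        (fun ω B hB => by rw [← hdens]; exact hpres ω B hB) y.2 hg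
      simp only [← originDensity_pathFlow (orbits Z) (vadd_mem_orbits Z)] at this
      exact this)
  have h2 := congrArg (Measure.map (pairVal (orbits Z))) h
  have hT : Measurable fun y : E × orbits Z => stateFlow hE Z (π y.2.1) y := by fun_prop
  rw [stateLaw, Measure.map_map hT hXZ, Measure.map_map hpv hXZ,
    Measure.map_map hpv (hT.comp hXZ)] at h2
  exact h2

theorem mecke_of_invariant_preservingShifts {ξ : Ω → Measure (Space d)} [Nontrivial (Space d)]
    (hdens : ∀ ω, ξ ω = pathMeasure (Z ω)) [SFinite (stateLaw P X Z)]
    (hline : ∀ (u : Space d), u ≠ 0 → ∀ z : orbits Z,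
      IsLineDensity (fun a => originDensity (orbits Z) ((orbitFlow Z).line u a z)))
    (hinv : InvariantUnderPreservingShifts P X Z ξ) :
    Mecke (stateFlow hE Z) volume (stateDensity E Z) (stateLaw P X Z) := by
  have hρ : Measurable (stateDensity E Z) :=
    (measurable_originDensity _).comp measurable_snd
  have hXZ : Measurable (fun ω => (X ω, orbitField Z ω)) :=
    hX.prodMk (measurable_orbitField hZ)
  have hEv : MeasurableVAdd₂ (Space d) E := ⟨hE⟩
  have hpv := measurable_pairVal (E := E) (orbits Z)
  refine mecke_of_line volume _ hρ fun u hu => ?_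
  have hl : ∀ y : E × orbits Z,
      IsLineDensity (fun a => stateDensity E Z ((stateFlow hE Z).line u a y)) :=
    fun y => hline u hu y.2
  refine mecke_of_invariant _ hl hρ fun r => ?_
  have hmt := measurable_massTime _ (hline u hu) (measurable_originDensity _)
  have hπm : Measurable (fun z : orbits Z => massTime _ (hline u hu) z r • u) := by fun_prop
  -- The mass shift is defined only on the orbits, while a preserving shift must be measurable on
  -- all of `H.paths`; its values off the orbits do not matter.
  obtain ⟨π, hπ, hππ⟩ := Measurable.exists_eq_measurable_comp (f := Subtype.val) hπm
  have hππ' : ∀ z : orbits Z, π z.1 = massTime _ (hline u hu) z r • u := fun z =>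
    (congrFun hππ z).symm
  have hP := hinv π ⟨hπ, fun ω B hB => by
    have hv : Measurable (fun s : Space d => s +ᵥ Z ω) :=
      H.measurable_vadd.comp (measurable_id.prodMk measurable_const)
    have hτ : Measurable (allocation π (Z ω)) := by
      unfold allocation
      fun_prop
    have hBi : Measurable (B.indicator (1 : Space d → ℝ≥0∞)) := measurable_one.indicator hB
    have := lintegral_comp_line_allocation (orbitFlow Z) u (hline u hu)
      (measurable_originDensity _) volume r (orbitField Z ω) _ hBi
    simp only [← hππ', originDensity_pathFlow] at this
    change ξ ω (allocation π (Z ω) ⁻¹' B) = ξ ω B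
    rw [hdens, ← lintegral_indicator_one (hτ hB), ← lintegral_indicator_one hB,
      lintegral_pathMeasure _ (measurable_one.indicator (hτ hB)), lintegral_pathMeasure _ hBi]
    exact this⟩
  apply map_pairVal_injective
  have hT : Measurable fun y : E × orbits Z => (stateFlow hE Z).line u (massTime _ hl y r) y := by
    have := measurable_massTime _ hl hρ
    fun_prop
  rw [stateLaw, Measure.map_map hT hXZ, Measure.map_map hpv hXZ,
    Measure.map_map hpv (hT.comp hXZ)]
  refine Eq.trans ?_ hP
  congr 1
  funext ω
  have h := hππ' (orbitField Z ω)
  rw [show π (Z ω) = π (orbitField Z ω).1 from rfl, h]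
  rfl

-- The law of `((X, Z), ξ)` is a measurable image of `stateLaw`, and σ-finiteness pulls back along
-- measurable maps.
omit [AddAction (Space d) E] hX in
theorem sigmaFinite_stateLaw {ξ : Ω → Measure (Space d)}
    (hdens : ∀ ω, ξ ω = pathMeasure (Z ω)) (hX : Measurable X)
    (hσ : SigmaFinite (P.map (fun ω => ((X ω, Z ω), ξ ω)))) :
    SigmaFinite (stateLaw P X Z) := by
  have hXZ : Measurable (fun ω => (X ω, orbitField Z ω)) :=
    hX.prodMk (measurable_orbitField hZ)
  have hpv := measurable_pairVal (E := E) (orbits Z)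
  have hj : Measurable (fun y : E × orbits Z => (pairVal (orbits Z) y, pathMeasure y.2.1)) := by
    fun_prop
  refine SigmaFinite.of_map _ hj.aemeasurable ?_
  rw [stateLaw, Measure.map_map hj hXZ]
  simp only [hdens] at hσ
  exact hσ

end Transfer

end MassShift

theorem theorem6 {d : ℕ} (hd : 1 ≤ d)
    {Ω : Type*} [MeasurableSpace Ω] (P : Measure Ω)
    {E : Type*} [MeasurableSpace E] [AddAction (MassShift.Space d) E]
    (hE : Measurable (fun p : MassShift.Space d × E => p.1 +ᵥ p.2))
    (X : Ω → E) (hX : Measurable X)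
    (H : MassShift.PathSpace d) (Z : Ω → H.paths) (hZ : Measurable Z)
    (ξ : Ω → Measure (MassShift.Space d)) (hξ : MassShift.IsRandomMeasure ξ)
    (hdens : MassShift.HasDensityField ξ Z)
    (hσ : SigmaFinite (P.map (fun ω => ((X ω, Z ω), ξ ω))))
    (hpos : ∀ ω (s : MassShift.Space d), 0 < (Z ω : MassShift.Space d → ℝ≥0) s)
    (hline : ∀ ω (x u : MassShift.Space d), u ≠ 0 →
      LocallyIntegrable
        (fun a : ℝ => ((Z ω : MassShift.Space d → ℝ≥0) (x + a • u) : ℝ)) volume)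
    (hhalf : ∀ ω (x u : MassShift.Space d), u ≠ 0 →
      ∫⁻ a in Set.Ici (0 : ℝ), ((Z ω : MassShift.Space d → ℝ≥0) (x + a • u) : ℝ≥0∞) = ⊤) :
    MassShift.MassStationary P (fun ω => (X ω, Z ω)) ξ ↔
      MassShift.InvariantUnderPreservingShifts P X Z ξ := by
  open MassShift in
  have : NeZero d := ⟨by omega⟩
  have : Nontrivial (Space d) := inferInstance
  have := sigmaFinite_stateLaw hZ hdens hX hσ
  rw [massStationary_iff hE hX hZ hdens, flowMassStationary_iff_mecke
    (ρ := stateDensity E Z) ((measurable_originDensity _).comp measurable_snd)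
    (fun y => originDensity_pos hpos y.2)
    (fun y r => lintegral_ball_orbit_ne_top hξ.locallyFinite hdens y.2 r)]
  exact ⟨invariant_of_mecke hE hX hZ hdens hpos hξ.locallyFinite,
    mecke_of_invariant_preservingShifts hE hX hZ hdens
      (fun u hu z => isLineDensity_orbit hpos hline hhalf hu z)⟩
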